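/- Let $n\ge 2$. On $\mathbb{C}^{n+1}$ let $((z,w))=-z_0\bar w_0+\sum_{k=1}^n z_k\bar w_k$, let $U(1,n)$ be the group of matrices preserving this form, let $H_1^{2n+1}=\{w:((w,w))=-1\}$, and let $\pi_-:H_1^{2n+1}\to\mathbb{CH}^n=H_1^{2n+1}/S^1$ be the Hopf fibration onto complex hyperbolic space, with the Riemannian metric $\langle X,Y\rangle=\mathrm{Re}((X',Y'))$ ($X',Y'$ horizontal lifts) of constant holomorphic sectional curvature $-4$ and complex structure $J$ induced by multiplication by $i$. Let $G$ be a smooth manifold of dimension $n-1$ and $g:G\to U(1,n)$ a smooth immersion, with $\Omega=g^{-1}dg$. Put $\mathbf J=(0,\infty)$ if $n\ge 3$, and $\mathbf J=\mathbb R$, $S^{0}=\{1\}$ if $n=2$. Define $$\tilde\Psi:S^1\times G\times\mathbb R\times\mathbf J\times S^{n-2}\to H_1^{2n+1},\qquad \tilde\Psi(e^{i\theta},x,h,\lambda,\mathbf p)=e^{i\theta}g(x)\begin{pmatrix}1+\lambda^2/2-ih\\-\lambda^2/2+ih\\\lambda\mathbf p\end{pmatrix},$$ and let $\Psi_g:M^{2n-1}=G\times\mathbb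 R\times\mathbf J\times S^{n-2}\to\mathbb{CH}^n$ be the map induced by $\pi_-\circ\tilde\Psi$. Assume that $\tilde\Psi$ and $\Psi_g$ are immersions. Then the following are equivalent. 1. $\Omega$ is a CKO-form, that is, $$\Omega=\begin{pmatrix} i\alpha_0&\frac i2(\alpha_0-\alpha_1)&{}^t\mathbf x-i\,{}^ty_0\\ \frac i2(\alpha_1-\alpha_0)&i\alpha_1&-{}^t\mathbf x+i\,{}^ty_1\\ \mathbf x+iy_0&\mathbf x+iy_1&w_1+iw_2\end{pmatrix}$$ for real $1$-forms $\alpha_0,\alpha_1$, $\mathbb R^{n-1}$-valued $1$-forms $\mathbf x,y_0,y_1$ with ${}^ty_0\wedge y_1=0$ (i.e. $\langle y_0(Y),y_1(Z)\rangle=\langle y_0(Z),y_1(Y)\rangle$ for all tangent vectors $Y,Z$ at the same point), and $1$-forms $w_1$, $w_2$ with values in the real alternating, respectively symmetric, $(n-1)\times(n-1)$ matrices, on $G$. 2. $\Psi_g$ is a real Hopf hypersurface of $\mathbb{CH}^n$ with $A\xi=2\xi$ and $\dim V_1\ge n-1$ everywhere: there is a smooth unit normal field $N$ along $\Psi_g$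 such that, at every point of $M$, the shape operator $A$ of $N$ (defined by $\tilde\nabla_XN=-AX$, with $\tilde\nabla$ the Levi-Civita connection of $\mathbb{CH}^n$) and the structure vector $\xi=-JN$ satisfy $A\xi=2\xi$, and the eigenspace $V_1$ of $A$ for the eigenvalue $1$ has dimension at least $n-1$. -/

import Mathlib

open Set Manifold ContDiff ComplexConjugate

noncomputable section

namespace CHn

/-! ### The Hermitian form, `U(1,n)`, anti de Sitter space -/

/-- The Hermitian form `((z,w)) = -z₀ w̄₀ + ∑ zₖ w̄ₖ` on `ℂ^{n+1}`. -/
def hform {n : ℕ} (z w : Fin (n + 1) → ℂ) : ℂ :=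
  -(z 0 * conj (w 0)) + ∑ k : Fin n, z k.succ * conj (w k.succ)

/-- `S = diag(-1, 1, …, 1)`. -/
def sig (n : ℕ) : Matrix (Fin (n + 1)) (Fin (n + 1)) ℂ :=
  Matrix.diagonal (Fin.cons (-1) (fun _ => 1))

/-- The group `U(1,n)`, as a subset of the space of complex matrices: `A* S A = S`. -/
def U1 (n : ℕ) : Set (Matrix (Fin (n + 1)) (Fin (n + 1)) ℂ) :=
  {A | A.conjTranspose * sig n * A = sig n}

/-- The anti de Sitter space `H₁^{2n+1} = {w : ((w,w)) = -1}`. -/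
def antiDeSitter (n : ℕ) : Set (Fin (n + 1) → ℂ) := {w | hform w w = -1}

/-! ### Complex hyperbolic space

`ℂHⁿ = H₁^{2n+1} / S¹` is realised through its global inhomogeneous coordinates
`[w] ↦ (w₁/w₀, …, wₙ/w₀)`, which identify it with the open unit ball of `ℂⁿ`. The tangent space at
every point is `ℂⁿ`, and the complex structure is multiplication by `i`. -/

/-- The points of `ℂHⁿ`: the open unit ball of `ℂⁿ`. -/
def ball (n : ℕ) : Set (EuclideanSpace ℂ (Fin n)) := {ζ | ‖ζ‖ < 1}

/-- The Hopf map `π₋ : H₁^{2n+1} → ℂHⁿ`. -/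
def hopf {n : ℕ} (w : Fin (n + 1) → ℂ) : EuclideanSpace ℂ (Fin n) :=
  WithLp.toLp 2 (fun k => w k.succ / w 0)

/-- The point `(1 - ‖ζ‖²)^{-1/2} (1, ζ)` of `H₁^{2n+1}` over `ζ`. -/
def lift {n : ℕ} (ζ : EuclideanSpace ℂ (Fin n)) : Fin (n + 1) → ℂ :=
  ((Real.sqrt (1 - ‖ζ‖ ^ 2))⁻¹ : ℂ) • (Fin.cons 1 (fun k => ζ k) : Fin (n + 1) → ℂ)

/-- The horizontal lift at `w ∈ H₁^{2n+1}` of a tangent vector `X` of `ℂHⁿ` at `hopf w`: the unique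
`X'` with `((X', w)) = 0` and `dπ₋ X' = X`
(see `hform_horLift_self` and `hasDerivAt_hopf_horLift`). -/
def horLift {n : ℕ} (w : Fin (n + 1) → ℂ) (X : EuclideanSpace ℂ (Fin n)) : Fin (n + 1) → ℂ :=
  let a : Fin (n + 1) → ℂ := Fin.cons 0 (fun k => w 0 * X k)
  a + hform a w • w

/-- The Riemannian metric of `ℂHⁿ`: `⟨X, Y⟩ = Re ((X', Y'))` for horizontal lifts `X'`, `Y'` (at any
point over `ζ`, see `hform_horLift`). -/
def metric {n : ℕ} (ζ X Y : EuclideanSpace ℂ (Fin n)) : ℝ :=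
  (hform (horLift (lift ζ) X) (horLift (lift ζ) Y)).re

/-- The Christoffel map `Γ_ζ(X, Y)` of the Levi-Civita connection of `metric`, so that
`∇̃_X Y = D_X Y + Γ(X, Y)`. It is symmetric (torsion-free) and compatible with the metric, see
`christoffel_symm` and `metric_compatible`. -/
def christoffel {n : ℕ} (ζ X Y : EuclideanSpace ℂ (Fin n)) : EuclideanSpace ℂ (Fin n) :=
  ((1 - ‖ζ‖ ^ 2 : ℝ) : ℂ)⁻¹ • (inner ℂ ζ X • Y + inner ℂ ζ Y • X)

/-! Facts which show that the definitions above are the intended ones. -/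

lemma hform_add_left {n : ℕ} (a b c : Fin (n + 1) → ℂ) :
    hform (a + b) c = hform a c + hform b c := by
  simp only [hform, Pi.add_apply, add_mul, Finset.sum_add_distrib]; ring

lemma hform_smul_left {n : ℕ} (t : ℂ) (a c : Fin (n + 1) → ℂ) :
    hform (t • a) c = t * hform a c := by
  simp only [hform, Pi.smul_apply, smul_eq_mul, mul_add, Finset.mul_sum, mul_assoc, mul_neg]

lemma hform_conj {n : ℕ} (a b : Fin (n + 1) → ℂ) : conj (hform a b) = hform b a := by
  simp [hform, map_sum, mul_comm]

lemma hform_add_right {n : ℕ} (a b c : Fin (n + 1) → ℂ) :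
    hform a (b + c) = hform a b + hform a c := by
  rw [← hform_conj, hform_add_left, map_add, hform_conj, hform_conj]

lemma hform_smul_right {n : ℕ} (t : ℂ) (a c : Fin (n + 1) → ℂ) :
    hform a (t • c) = conj t * hform a c := by
  rw [← hform_conj, hform_smul_left, map_mul, hform_conj]

/-- A point of `H₁^{2n+1}` in terms of its image in the ball. -/
lemma normSq_of_mem {n : ℕ} {w : Fin (n + 1) → ℂ} (hw : w ∈ antiDeSitter n) :
    w 0 ≠ 0 ∧ ((1 - ‖hopf w‖ ^ 2 : ℝ) : ℂ) * (w 0 * conj (w 0)) = 1 := by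
  have h : hform w w = -1 := hw
  have h0 : w 0 ≠ 0 := by
    intro h0
    simp only [hform, h0, zero_mul, neg_zero, zero_add, Complex.mul_conj] at h
    have h2 := congrArg Complex.re h
    rw [← Complex.ofReal_sum, Complex.ofReal_re] at h2
    have h3 : 0 ≤ ∑ i : Fin n, Complex.normSq (w i.succ) :=
      Finset.sum_nonneg fun i _ => Complex.normSq_nonneg _
    simp at h2
    linarith
  refine ⟨h0, ?_⟩
  rw [EuclideanSpace.norm_sq_eq]
  simp only [hform, Complex.mul_conj] at h ⊢
  simp only [hopf, norm_div, div_pow, ← Finset.sum_div, Complex.normSq_eq_norm_sq] at h ⊢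
  have h0' : (‖w 0‖ : ℂ) ≠ 0 := by simpa using h0
  push_cast at h ⊢
  field_simp
  linear_combination -h

/-- `hopf` maps `H₁^{2n+1}` onto the ball. -/
lemma hopf_mem_ball {n : ℕ} {w : Fin (n + 1) → ℂ} (hw : w ∈ antiDeSitter n) :
    hopf w ∈ ball n := by
  obtain ⟨h0, h1⟩ := normSq_of_mem hw
  rw [Complex.mul_conj] at h1
  have h2 : (1 - ‖hopf w‖ ^ 2) * Complex.normSq (w 0) = 1 := by exact_mod_cast h1
  have h3 : 0 < Complex.normSq (w 0) := Complex.normSq_pos.2 h0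
  have h4 : 0 < 1 - ‖hopf w‖ ^ 2 := by
    by_contra hc
    nlinarith
  simp only [ball, mem_ofPred_eq]
  nlinarith [norm_nonneg (hopf w)]

lemma ball_pos {n : ℕ} {ζ : EuclideanSpace ℂ (Fin n)} (hζ : ζ ∈ ball n) : 0 < 1 - ‖ζ‖ ^ 2 := by
  have h : ‖ζ‖ < 1 := hζ
  nlinarith [norm_nonneg ζ]

lemma hopf_lift {n : ℕ} {ζ : EuclideanSpace ℂ (Fin n)} (hζ : ζ ∈ ball n) :
    hopf (lift ζ) = ζ := by
  have h1 : (Real.sqrt (1 - ‖ζ‖ ^ 2) : ℂ) ≠ 0 := by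
    exact_mod_cast (Real.sqrt_pos.2 (ball_pos hζ)).ne'
  ext i
  simp only [hopf, lift, Pi.smul_apply, Fin.cons_succ, Fin.cons_zero, smul_eq_mul]
  field_simp

lemma lift_mem {n : ℕ} {ζ : EuclideanSpace ℂ (Fin n)} (hζ : ζ ∈ ball n) :
    lift ζ ∈ antiDeSitter n := by
  have h0 := ball_pos hζ
  have h1 : (Real.sqrt (1 - ‖ζ‖ ^ 2) : ℂ) ≠ 0 := by
    exact_mod_cast (Real.sqrt_pos.2 h0).ne'
  have h2 : (Real.sqrt (1 - ‖ζ‖ ^ 2) : ℂ) ^ 2 = 1 - (‖ζ‖ : ℂ) ^ 2 := by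
    exact_mod_cast Real.sq_sqrt h0.le
  have h3 : (‖ζ‖ : ℂ) ^ 2 = ∑ i, ζ i * conj (ζ i) := by
    simp only [Complex.mul_conj, Complex.normSq_eq_norm_sq]
    exact_mod_cast EuclideanSpace.norm_sq_eq ζ
  simp only [antiDeSitter, mem_ofPred_eq, lift, hform_smul_left, hform_smul_right]
  simp only [hform, Fin.cons_zero, Fin.cons_succ, ← h3, map_one, map_inv₀, Complex.conj_ofReal]
  field_simp
  rw [h2]; ring

/-- The fibres of `hopf` on `H₁^{2n+1}` are the orbits of `S¹`. -/
lemma hopf_eq_iff {n : ℕ} {w w' : Fin (n + 1) → ℂ} (hw : w ∈ antiDeSitter n)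
    (hw' : w' ∈ antiDeSitter n) : hopf w = hopf w' ↔ ∃ c : ℂ, ‖c‖ = 1 ∧ w' = c • w := by
  obtain ⟨h0, h1⟩ := normSq_of_mem hw
  obtain ⟨h0', h1'⟩ := normSq_of_mem hw'
  constructor
  · intro h
    refine ⟨w' 0 / w 0, ?_, ?_⟩
    · rw [← h] at h1'
      have h2 : (w 0 * conj (w 0)) = (w' 0 * conj (w' 0)) := by
        have h3 := left_ne_zero_of_mul_eq_one h1
        exact mul_left_cancel₀ h3 (h1.trans h1'.symm)
      rw [Complex.mul_conj, Complex.mul_conj, Complex.normSq_eq_norm_sq,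
        Complex.normSq_eq_norm_sq] at h2
      have h3 : ‖w 0‖ ^ 2 = ‖w' 0‖ ^ 2 := by exact_mod_cast h2
      have h4 : ‖w 0‖ = ‖w' 0‖ :=
        (pow_left_inj₀ (norm_nonneg _) (norm_nonneg _) two_ne_zero).1 h3
      rw [norm_div, h4, div_self (norm_ne_zero_iff.2 h0')]
    · funext i
      refine Fin.cases ?_ (fun j => ?_) i
      · simp [h0]
      · have h2 := congrFun (congrArg WithLp.ofLp h) j
        simp only [hopf] at h2
        simp only [Pi.smul_apply, smul_eq_mul]
        field_simp at h2 ⊢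
        linear_combination -h2
  · rintro ⟨c, hc, rfl⟩
    have hc0 : c ≠ 0 := by rintro rfl; simp at hc
    ext i
    simp only [hopf, Pi.smul_apply, smul_eq_mul]
    rw [mul_div_mul_left _ _ hc0]

/-- Horizontal lifts are horizontal. -/
lemma hform_horLift_self {n : ℕ} {w : Fin (n + 1) → ℂ} (hw : w ∈ antiDeSitter n)
    (X : EuclideanSpace ℂ (Fin n)) : hform (horLift w X) w = 0 := by
  have h : hform w w = -1 := hw
  simp only [horLift, hform_add_left, hform_smul_left, h]
  ring

/-- Horizontal lifts are mapped by `dπ₋` to the original vector. -/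
lemma hasDerivAt_hopf_horLift {n : ℕ} {w : Fin (n + 1) → ℂ} (hw : w ∈ antiDeSitter n)
    (X : EuclideanSpace ℂ (Fin n)) :
    HasDerivAt (fun t : ℝ => hopf (w + (t : ℂ) • horLift w X)) X 0 := by
  obtain ⟨h0, -⟩ := normSq_of_mem hw
  suffices H : ∀ i, HasDerivAt (fun t : ℝ => (w + (t : ℂ) • horLift w X) i.succ /
      (w + (t : ℂ) • horLift w X) 0) (X i) 0 from
    ((PiLp.continuousLinearEquiv 2 ℝ (fun _ : Fin n => ℂ)).symm.hasFDerivAt).comp_hasDerivAt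
      (0 : ℝ) (hasDerivAt_pi.2 H)
  intro i
  have hd : ∀ j, HasDerivAt (fun t : ℝ => w j + (t : ℂ) * horLift w X j) (horLift w X j) 0 := by
    intro j
    have h1 : HasDerivAt (fun t : ℝ => (t : ℂ)) 1 0 := Complex.ofRealCLM.hasDerivAt
    simpa using (h1.mul_const (horLift w X j)).const_add (w j)
  have := (hd i.succ).div (hd 0) (by simpa using h0)
  refine HasDerivAt.congr_deriv this ?_
  simp only [horLift, Pi.add_apply, Pi.smul_apply, smul_eq_mul, Fin.cons_zero, Fin.cons_succ,
    Complex.ofReal_zero, zero_mul, add_zero]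
  field_simp
  ring

/-- The Hermitian product of two horizontal lifts at `w` depends only on `hopf w`. -/
lemma hform_horLift {n : ℕ} {w : Fin (n + 1) → ℂ} (hw : w ∈ antiDeSitter n)
    (X Y : EuclideanSpace ℂ (Fin n)) :
    hform (horLift w X) (horLift w Y) =
      ((1 - ‖hopf w‖ ^ 2 : ℝ) : ℂ)⁻¹ * inner ℂ Y X +
        (((1 - ‖hopf w‖ ^ 2 : ℝ) : ℂ)⁻¹) ^ 2 * (inner ℂ (hopf w) X * inner ℂ Y (hopf w)) := by
  obtain ⟨h0, h1⟩ := normSq_of_mem hw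
  have h : hform w w = -1 := hw
  have hX : ∀ Z : EuclideanSpace ℂ (Fin n),
      hform (Fin.cons 0 (fun k => w 0 * Z k) : Fin (n + 1) → ℂ) w =
        (w 0 * conj (w 0)) * inner ℂ (hopf w) Z := by
    intro Z
    simp only [hform, Fin.cons_zero, Fin.cons_succ, zero_mul, neg_zero, zero_add, PiLp.inner_apply,
      RCLike.inner_apply, Finset.mul_sum, hopf, map_div₀]
    refine Finset.sum_congr rfl fun i _ => ?_
    have : conj (w 0) ≠ 0 := by simpa using h0
    field_simp
  have hXY : hform (Fin.cons 0 (fun k => w 0 * X k) : Fin (n + 1) → ℂ)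
      (Fin.cons 0 (fun k => w 0 * Y k) : Fin (n + 1) → ℂ) =
        (w 0 * conj (w 0)) * inner ℂ Y X := by
    simp only [hform, Fin.cons_zero, Fin.cons_succ, zero_mul, neg_zero, zero_add, PiLp.inner_apply,
      RCLike.inner_apply, Finset.mul_sum, map_mul]
    exact Finset.sum_congr rfl fun i _ => by ring
  have hinv : ((1 - ‖hopf w‖ ^ 2 : ℝ) : ℂ)⁻¹ = w 0 * conj (w 0) := 
    inv_eq_of_mul_eq_one_right h1
  rw [hinv]
  simp only [horLift, hform_add_left, hform_add_right, hform_smul_left, hform_smul_right, h, hX, hXY]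
  rw [← hform_conj _ w, hX]
  simp only [map_mul, Complex.conj_conj, inner_conj_symm]
  ring

/-- The metric in coordinates. -/
lemma metric_eq {n : ℕ} {ζ : EuclideanSpace ℂ (Fin n)} (hζ : ζ ∈ ball n)
    (X Y : EuclideanSpace ℂ (Fin n)) :
    metric ζ X Y = (1 - ‖ζ‖ ^ 2)⁻¹ * (inner ℂ Y X : ℂ).re +
      ((1 - ‖ζ‖ ^ 2)⁻¹) ^ 2 * (inner ℂ ζ X * inner ℂ Y ζ : ℂ).re := by
  rw [metric, hform_horLift (lift_mem hζ), hopf_lift hζ, ← Complex.ofReal_inv,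
    ← Complex.ofReal_pow, Complex.add_re, Complex.re_ofReal_mul, Complex.re_ofReal_mul]

/-- The connection is torsion-free. -/
lemma christoffel_symm {n : ℕ} (ζ X Y : EuclideanSpace ℂ (Fin n)) :
    christoffel ζ X Y = christoffel ζ Y X := by
  rw [christoffel, christoffel, add_comm]

/-- The connection is compatible with the metric. -/
lemma metric_compatible {n : ℕ} {ζ : EuclideanSpace ℂ (Fin n)} (hζ : ζ ∈ ball n)
    (X Y Z : EuclideanSpace ℂ (Fin n)) :
    HasDerivAt (fun t : ℝ => metric (ζ + (t : ℂ) • X) Y Z)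
      (metric ζ (christoffel ζ X Y) Z + metric ζ Y (christoffel ζ X Z)) 0 := by
  have hpos := ball_pos hζ
  have hcont : Continuous fun t : ℝ => ζ + (t : ℂ) • X := by fun_prop
  have hev : ∀ᶠ t : ℝ in nhds 0, ζ + (t : ℂ) • X ∈ ball n := by
    have ho : IsOpen (ball n) := isOpen_lt continuous_norm continuous_const
    exact hcont.continuousAt.eventually_mem (ho.mem_nhds (by simpa using hζ))
  have hre : HasDerivAt (fun t : ℝ => (t : ℂ)) 1 0 := Complex.ofRealCLM.hasDerivAt
  have hs : HasDerivAt (fun t : ℝ => ζ + (t : ℂ) • X) X 0 := by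
    simpa using (hre.smul_const X).const_add ζ
  have hn : HasDerivAt (fun t : ℝ => 1 - ‖ζ + (t : ℂ) • X‖ ^ 2) (-(2 * (inner ℂ ζ X : ℂ).re)) 0 := by
    have he : (fun t : ℝ => 1 - ‖ζ + (t : ℂ) • X‖ ^ 2) =
        fun t : ℝ => 1 - (‖ζ‖ ^ 2 + 2 * (t * (inner ℂ ζ X : ℂ).re) + t ^ 2 * ‖X‖ ^ 2) := by
      funext t
      rw [@norm_add_sq ℂ, inner_smul_right, norm_smul, mul_pow]
      simp
    rw [he]
    have h1 := ((((hasDerivAt_id (0 : ℝ)).mul_const (inner ℂ ζ X : ℂ).re).const_mul 2).const_add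
      (‖ζ‖ ^ 2)).add ((hasDerivAt_pow 2 (0 : ℝ)).mul_const (‖X‖ ^ 2))
    simpa using h1.const_sub 1
  have h1 : HasDerivAt (fun t : ℝ => inner ℂ (ζ + (t : ℂ) • X) Y) (inner ℂ X Y) 0 := by
    have he : (fun t : ℝ => inner ℂ (ζ + (t : ℂ) • X) Y) =
        fun t : ℝ => inner ℂ ζ Y + (t : ℂ) * inner ℂ X Y := by
      funext t
      rw [inner_add_left, inner_smul_left, Complex.conj_ofReal]
    rw [he]
    simpa using (hre.mul_const (inner ℂ X Y)).const_add (inner ℂ ζ Y)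
  have h2 : HasDerivAt (fun t : ℝ => inner ℂ Z (ζ + (t : ℂ) • X)) (inner ℂ Z X) 0 := by
    have he : (fun t : ℝ => inner ℂ Z (ζ + (t : ℂ) • X)) =
        fun t : ℝ => inner ℂ Z ζ + (t : ℂ) * inner ℂ Z X := by
      funext t
      rw [inner_add_right, inner_smul_right]
    rw [he]
    simpa using (hre.mul_const (inner ℂ Z X)).const_add (inner ℂ Z ζ)
  have h3 := Complex.reCLM.hasFDerivAt.comp_hasDerivAt (0 : ℝ) (h1.mul h2)
  have hi := hn.inv (by simpa using hpos.ne')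
  have h4 := (hi.mul_const (inner ℂ Z Y : ℂ).re).add ((hi.pow 2).mul h3)
  refine (h4.congr_of_eventuallyEq (hev.mono fun t ht => ?_)).congr_deriv ?_
  · rw [metric_eq ht]
    rfl
  · rw [metric_eq hζ, metric_eq hζ]
    have c1 : (inner ℂ X ζ : ℂ) = conj (inner ℂ ζ X) := (inner_conj_symm _ _).symm
    have c2 : (inner ℂ Z ζ : ℂ) = conj (inner ℂ ζ Z) := (inner_conj_symm _ _).symm
    have hG : ∀ A B : EuclideanSpace ℂ (Fin n), christoffel ζ A B =
        (((1 - ‖ζ‖ ^ 2)⁻¹ : ℝ) : ℂ) • (inner ℂ ζ A • B + inner ℂ ζ B • A) := by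
      intro A B
      rw [christoffel, Complex.ofReal_inv]
    have hr : ∀ b : ℝ, b / (1 - ‖ζ‖ ^ 2) ^ 2 = b * ((1 - ‖ζ‖ ^ 2)⁻¹) ^ 2 := by
      intro b
      rw [inv_pow, div_eq_mul_inv]
    simp only [hG, Complex.ofReal_zero, zero_smul, add_zero, hr, Pi.inv_apply, Pi.pow_apply,
      Pi.mul_apply, Function.comp_apply, inner_smul_left, inner_smul_right, inner_add_left,
      inner_add_right, c1, c2, map_add, zero_mul, Complex.conj_ofReal, Complex.reCLM_apply]
    generalize (1 - ‖ζ‖ ^ 2)⁻¹ = r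
    simp only [Complex.add_re, Complex.add_im, Complex.mul_re, Complex.mul_im, Complex.ofReal_re,
      Complex.ofReal_im, Complex.conj_re, Complex.conj_im]
    push_cast
    ring

/-! ### Real hypersurfaces of `ℂHⁿ` -/

section Hypersurface

variable {E H M : Type*} [NormedAddCommGroup E] [NormedSpace ℝ E] [TopologicalSpace H]
  (I : ModelWithCorners ℝ E H) [TopologicalSpace M] [ChartedSpace H M]

/-- The differential at `q` of a map `f` from the manifold `M` to the vector space `F`. -/
def differential {F : Type*} [NormedAddCommGroup F] [NormedSpace ℝ F] (f : M → F) (q : M) :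
    TangentSpace I q →ₗ[ℝ] F :=
  (mfderiv I 𝓘(ℝ, F) f q).toLinearMap

/-- `f`, restricted to the open set `D` of the manifold `M`, is a smooth immersion into the vector
space `F`: it is smooth and its differential is injective at each point of `D`. For a map with
values in an embedded submanifold of `F` this is the same as being an immersion into it. -/
def IsImmersionOn {F : Type*} [NormedAddCommGroup F] [NormedSpace ℝ F] (f : M → F) (D : Set M) :
    Prop :=
  ContMDiffOn I 𝓘(ℝ, F) ∞ f D ∧ ∀ q ∈ D, Function.Injective (differential I f q)

variable {n : ℕ}

/-- `N` is a smooth unit normal vector field along `Ψ : D → ℂHⁿ`, where `D ⊆ M` is open. -/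
def IsUnitNormalOn (Ψ N : M → EuclideanSpace ℂ (Fin n)) (D : Set M) : Prop :=
  ContMDiffOn I 𝓘(ℝ, EuclideanSpace ℂ (Fin n)) ∞ N D ∧
  ∀ q ∈ D, metric (Ψ q) (N q) (N q) = 1 ∧
    ∀ v : TangentSpace I q,
      metric (Ψ q) (differential I Ψ q v) (N q) = 0

/-- The Levi-Civita derivative `∇̃_v V` of a vector field `V` along `Ψ : M → ℂHⁿ`. -/
def covDeriv (Ψ V : M → EuclideanSpace ℂ (Fin n)) (q : M) (v : TangentSpace I q) :
    EuclideanSpace ℂ (Fin n) :=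
  differential I V q v + christoffel (Ψ q) (differential I Ψ q v) (V q)

/-- `A` is the shape operator (Weingarten endomorphism) at `q` of the hypersurface `Ψ` with unit
normal field `N`: `∇̃_v N = -dΨ(A v)`. -/
def IsShapeOperatorAt (Ψ N : M → EuclideanSpace ℂ (Fin n)) (q : M)
    (A : Module.End ℝ (TangentSpace I q)) : Prop :=
  ∀ v, covDeriv I Ψ N q v = -differential I Ψ q (A v)

/-- `ξ` is the structure vector `-J N` at `q`. -/
def IsStructureVectorAt (Ψ N : M → EuclideanSpace ℂ (Fin n)) (q : M) (ξ : TangentSpace I q) :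
    Prop :=
  differential I Ψ q ξ = -(Complex.I • N q)

/-- The immersion `Ψ : D → ℂHⁿ` is a real Hopf hypersurface: `M` has dimension `2n - 1` and, for
some unit normal field `N` with shape operator `A` and structure vector `ξ`, one has `A ξ = μ ξ` with
constant Hopf curvature `μ`, and at each point the eigenspace `V_ρ` of `A` has dimension at least
`d`. -/
def IsHopfWithEigenspace (Ψ : M → EuclideanSpace ℂ (Fin n)) (D : Set M) (μ ρ : ℝ) (d : ℕ) : Prop :=
  Module.finrank ℝ E + 1 = 2 * n ∧ MapsTo Ψ D (ball n) ∧ IsImmersionOn I Ψ D ∧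
  ∃ N : M → EuclideanSpace ℂ (Fin n), IsUnitNormalOn I Ψ N D ∧
    ∀ q ∈ D, ∃ A : Module.End ℝ (TangentSpace I q), IsShapeOperatorAt I Ψ N q A ∧
      (∃ ξ : TangentSpace I q, IsStructureVectorAt I Ψ N q ξ ∧ A ξ = μ • ξ) ∧
      d ≤ Module.finrank ℝ (Module.End.eigenspace A ρ)

end Hypersurface

/-! ### CKO-forms

Below, `n = k + 2`, so that `n - 1 = k + 1` and `n - 2 = k`. -/

/-- The shape of the values of a CKO-form, `m = n - 1`. -/
def ckoMatrix {m : ℕ} (a₀ a₁ : ℝ) (x y₀ y₁ : Fin m → ℝ) (w₁ w₂ : Matrix (Fin m) (Fin m) ℝ) :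
    Matrix (Fin (m + 2)) (Fin (m + 2)) ℂ :=
  Matrix.of (Fin.cons
    (Fin.cons (Complex.I * a₀)
      (Fin.cons (Complex.I / 2 * (a₀ - a₁)) (fun j => (x j : ℂ) - Complex.I * y₀ j)))
    (Fin.cons
      (Fin.cons (Complex.I / 2 * (a₁ - a₀))
        (Fin.cons (Complex.I * a₁) (fun j => -(x j : ℂ) + Complex.I * y₁ j)))
      (fun i => Fin.cons ((x i : ℂ) + Complex.I * y₀ i)
        (Fin.cons ((x i : ℂ) + Complex.I * y₁ i)
          (fun j => (w₁ i j : ℂ) + Complex.I * w₂ i j)))))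

section Forms

variable {k : ℕ} {G : Type*} [TopologicalSpace G]
  [ChartedSpace (EuclideanSpace ℝ (Fin (k + 1))) G]

/-- `g : G → U(1,n)` as a map into the vector space of arrays of entries. -/
def entries (g : G → Matrix (Fin (k + 3)) (Fin (k + 3)) ℂ) : G → Fin (k + 3) → Fin (k + 3) → ℂ :=
  fun x => Matrix.of.symm (g x)

/-- The form `Ω = g⁻¹ dg`. -/
def maurerCartan (g : G → Matrix (Fin (k + 3)) (Fin (k + 3)) ℂ) (x : G) :
    TangentSpace (𝓡 (k + 1)) x →ₗ[ℝ] Matrix (Fin (k + 3)) (Fin (k + 3)) ℂ :=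
  LinearMap.mulLeft ℝ (g x)⁻¹ ∘ₗ (Matrix.ofLinearEquiv ℝ).toLinearMap ∘ₗ
    differential (𝓡 (k + 1)) (entries g) x

/-- `Ω` is a CKO-form. The component forms are real-linear functions of the entries of `Ω`, so they
are as smooth as `Ω`. The last clause is `ᵗy₀ ∧ y₁ = 0`. -/
def IsCKO (Ω : ∀ x : G, TangentSpace (𝓡 (k + 1)) x →ₗ[ℝ]
    Matrix (Fin (k + 3)) (Fin (k + 3)) ℂ) : Prop :=
  ∃ (α₀ α₁ : ∀ x : G, TangentSpace (𝓡 (k + 1)) x →ₗ[ℝ] ℝ)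
    (ξ y₀ y₁ : ∀ x : G, TangentSpace (𝓡 (k + 1)) x →ₗ[ℝ] (Fin (k + 1) → ℝ))
    (w₁ w₂ : ∀ x : G, TangentSpace (𝓡 (k + 1)) x →ₗ[ℝ] Matrix (Fin (k + 1)) (Fin (k + 1)) ℝ),
    (∀ x Y, (w₁ x Y).transpose = -w₁ x Y ∧ (w₂ x Y).transpose = w₂ x Y) ∧
    (∀ x Y, Ω x Y =
      ckoMatrix (α₀ x Y) (α₁ x Y) (ξ x Y) (y₀ x Y) (y₁ x Y) (w₁ x Y) (w₂ x Y)) ∧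
    ∀ x Y Z, y₀ x Y ⬝ᵥ y₁ x Z - y₀ x Z ⬝ᵥ y₁ x Y = 0

end Forms

/-! ### The maps `Ψ̃` and `Ψ_g` -/

/-- The sphere `S^{n-2}` in `ℝ^{n-1}`, where `n = k + 2`. -/
abbrev Sph (k : ℕ) : Type := Metric.sphere (0 : EuclideanSpace ℝ (Fin (k + 1))) 1

/-- The model of `G × ℝ × ℝ × S^{n-2}`. -/
abbrev modelM (k : ℕ) :=
  (𝓡 (k + 1)).prod (𝓘(ℝ, ℝ).prod (𝓘(ℝ, ℝ).prod (𝓡 k)))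

/-- `M = G × ℝ × J × S^{n-2}`, with points `(x, h, λ, p)`, as an open subset of
`G × ℝ × ℝ × S^{n-2}`: for `n ≥ 3` it is given by `λ > 0`; for `n = 2`, `λ` is an arbitrary real
number and `S⁰ = {±1}` is restricted to its point `p = 1`. -/
def domM (k : ℕ) (G : Type*) : Set (G × ℝ × ℝ × Sph k) :=
  {q | if k = 0 then q.2.2.2.1 0 = 1 else 0 < q.2.2.1}

/-- The vector `(1 + λ²/2 - i h, -λ²/2 + i h, λ p)`. -/
def horoVec {k : ℕ} (h l : ℝ) (p : Sph k) : Fin (k + 3) → ℂ :=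
  Fin.cons (1 + (l : ℂ) ^ 2 / 2 - Complex.I * h)
    (Fin.cons (-(l : ℂ) ^ 2 / 2 + Complex.I * h) (fun j => (l : ℂ) * (p.1 j : ℝ)))

/-- `Ψ̃(e^{iθ}, x, h, λ, p) = e^{iθ} g(x) (1 + λ²/2 - i h, -λ²/2 + i h, λ p)`. -/
def PsiTilde {k : ℕ} {G : Type*} (g : G → Matrix (Fin (k + 3)) (Fin (k + 3)) ℂ)
    (q : Circle × G × ℝ × ℝ × Sph k) : Fin (k + 3) → ℂ :=
  (q.1 : ℂ) • (g q.2.1).mulVec (horoVec q.2.2.1 q.2.2.2.1 q.2.2.2.2)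

/-- The map `Ψ_g : M → ℂHⁿ` induced by `Ψ̃`, see `hopf_PsiTilde`. -/
def PsiG {k : ℕ} {G : Type*} (g : G → Matrix (Fin (k + 3)) (Fin (k + 3)) ℂ)
    (q : G × ℝ × ℝ × Sph k) : EuclideanSpace ℂ (Fin (k + 2)) :=
  hopf (PsiTilde g (1, q))

lemma hopf_PsiTilde {k : ℕ} {G : Type*} (g : G → Matrix (Fin (k + 3)) (Fin (k + 3)) ℂ)
    (q : Circle × G × ℝ × ℝ × Sph k) : hopf (PsiTilde g q) = PsiG g q.2 := by
  ext i
  simp only [PsiG, hopf, PsiTilde, Pi.smul_apply, smul_eq_mul]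
  rw [mul_div_mul_left _ _ (Circle.coe_ne_zero _), mul_div_mul_left _ _ (Circle.coe_ne_zero _)]

lemma isOpen_domM (k : ℕ) (G : Type*) [TopologicalSpace G] : IsOpen (domM k G) := by
  by_cases hk : k = 0
  · subst hk
    have h : domM 0 G = {q | 0 < q.2.2.2.1 0} := by
      ext q
      have h1 : ‖q.2.2.2.1‖ = 1 := by simp
      have h2 : q.2.2.2.1 0 ^ 2 = 1 := by
        have := EuclideanSpace.real_norm_sq_eq q.2.2.2.1
        simpa [h1] using this.symm
      have h3 : q.2.2.2.1 0 = 1 ∨ q.2.2.2.1 0 = -1 := by simpa using h2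
      simp only [domM, if_true, mem_ofPred_eq]
      constructor
      · intro h; rw [h]; exact one_pos
      · intro h; rcases h3 with h3 | h3
        · exact h3
        · linarith
    rw [h]
    exact isOpen_lt continuous_const (by fun_prop)
  · have h : domM k G = {q | 0 < q.2.2.1} := by
      ext q
      simp [domM, hk]
    rw [h]
    exact isOpen_lt continuous_const (by fun_prop)

end CHn

end

noncomputable section

namespace CHn

/-! ### Algebra of the Hermitian form -/

/-! Write ℓ for `nullVec`, y = λp, u for `horoPoint h y`, T(s,c) for `horoTangent y s c`, and w = gu
for the lift of Ψ_g with θ = 0. Both statements are compared with one condition, (*): Re((u, Ωℓ)) =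
0 at the points u of the family. The vector g(ℓ - u) is horizontal of length 1 and real-orthogonal
to every gT(s,c). Since Ω is skew, (*) says that it is also orthogonal to every gΩu, that is, that
it lifts a unit normal of Ψ_g.

From 1 to 2: a CKO matrix makes Ωℓ purely imaginary with first two entries opposite, and (*) follows
(`re_hform_horoPoint_ckoMatrix`). With N = dπ(g(ℓ - u)), the derivative in a direction with
coordinates (0,s,c), where Ω does not enter, is ∇N = -dΨ + isN. The directions (0,0,c) thus lie in
V_1 and fill n - 1 dimensions. The direction (0,1,0) is ξ, because T(1,0) = -iℓ, and there the two
terms add up to the eigenvalue 2 (`isHopf_of_orthogonal`).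

From 2 to 1: orthogonality to the T(s,c) leaves ν = g(a(ℓ - u) + iT(0,b)), a² + |b|² = 1, as the
possible lifts of N. Pairing ∇_ξN = -2ξ with -ig(ℓ - u) gives (a - 1)² = 0, so a = 1 and b = 0
(`horLift_normal_eq`), and (*) follows. The left side of (*) is affine in h and λ for p = e_j; its
coefficients are the linear relations defining the CKO shape (`eq_ckoMatrix`). Finally ᵗy₀ ∧ y₁ = 0
is the integrability condition d² = 0 for the relation Re((d(ge₀), gℓ)) = 0
(`re_hform_differential_symm`). -/

lemma hform_neg_left {n : ℕ} (a c : Fin (n + 1) → ℂ) : hform (-a) c = -hform a c := by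
  simpa using hform_smul_left (-1) a c

lemma hform_neg_right {n : ℕ} (a c : Fin (n + 1) → ℂ) : hform a (-c) = -hform a c := by
  simpa using hform_smul_right (-1) a c

lemma hform_sub_left {n : ℕ} (a b c : Fin (n + 1) → ℂ) :
    hform (a - b) c = hform a c - hform b c := by
  rw [sub_eq_add_neg, hform_add_left, hform_neg_left, sub_eq_add_neg]

lemma hform_sub_right {n : ℕ} (a b c : Fin (n + 1) → ℂ) :
    hform a (b - c) = hform a b - hform a c := by
  rw [sub_eq_add_neg, hform_add_right, hform_neg_right, sub_eq_add_neg]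

lemma hform_re_comm {n : ℕ} (a b : Fin (n + 1) → ℂ) : (hform a b).re = (hform b a).re := by
  rw [← hform_conj, Complex.conj_re]

lemma hform_cons_cons {m : ℕ} (a₀ a₁ b₀ b₁ : ℂ) (a b : Fin m → ℂ) :
    hform (Fin.cons a₀ (Fin.cons a₁ a) : Fin (m + 2) → ℂ) (Fin.cons b₀ (Fin.cons b₁ b)) =
      -(a₀ * conj b₀) + a₁ * conj b₁ + ∑ j, a j * conj (b j) := by
  simp only [hform, Fin.sum_univ_succ, Fin.cons_zero, Fin.cons_succ]; ring

lemma _root_.HasDerivAt.hform {n : ℕ} {a b : ℝ → Fin (n + 1) → ℂ} {a' b' : Fin (n + 1) → ℂ} {t : ℝ}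
    (ha : HasDerivAt a a' t) (hb : HasDerivAt b b' t) :
    HasDerivAt (fun s => hform (a s) (b s)) (hform a' (b t) + hform (a t) b') t := by
  have hc : ∀ i, HasDerivAt (fun s => conj (b s i)) (conj (b' i)) t := fun i =>
    Complex.conjCLE.toContinuousLinearMap.hasFDerivAt.comp_hasDerivAt t (hasDerivAt_pi.1 hb i)
  have h := fun i => (hasDerivAt_pi.1 ha i).mul (hc i)
  refine ((h 0).neg.add (HasDerivAt.fun_sum fun (k : Fin n) _ => h k.succ)).congr_deriv ?_
  simp only [CHn.hform, Finset.sum_add_distrib]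
  ring

lemma _root_.HasDerivAt.re {f : ℝ → ℂ} {f' : ℂ} {t : ℝ} (h : HasDerivAt f f' t) :
    HasDerivAt (fun s => (f s).re) f'.re t :=
  Complex.reCLM.hasFDerivAt.comp_hasDerivAt t h

/-! ### The differential of the Hopf map -/

/-- The differential at `w` of the Hopf map, applied to `z`. -/
def dhopf {n : ℕ} (w z : Fin (n + 1) → ℂ) : EuclideanSpace ℂ (Fin n) :=
  WithLp.toLp 2 (fun k => (z k.succ - w k.succ / w 0 * z 0) / w 0)

lemma dhopf_apply {n : ℕ} (w z : Fin (n + 1) → ℂ) (k : Fin n) :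
    dhopf w z k = (z k.succ - w k.succ / w 0 * z 0) / w 0 := rfl

lemma dhopf_add {n : ℕ} (w z z' : Fin (n + 1) → ℂ) :
    dhopf w (z + z') = dhopf w z + dhopf w z' := by
  ext k; simp only [dhopf_apply, PiLp.add_apply, Pi.add_apply]; ring

lemma dhopf_smul {n : ℕ} (w z : Fin (n + 1) → ℂ) (c : ℂ) : dhopf w (c • z) = c • dhopf w z := by
  ext k; simp only [dhopf_apply, PiLp.smul_apply, Pi.smul_apply, smul_eq_mul]; ring

lemma dhopf_sub {n : ℕ} (w z z' : Fin (n + 1) → ℂ) :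
    dhopf w (z - z') = dhopf w z - dhopf w z' := by
  ext k; simp only [dhopf_apply, PiLp.sub_apply, Pi.sub_apply]; ring

lemma dhopf_neg {n : ℕ} (w z : Fin (n + 1) → ℂ) : dhopf w (-z) = -dhopf w z := by
  ext k; simp only [dhopf_apply, PiLp.neg_apply, Pi.neg_apply]; ring

@[simp] lemma dhopf_zero {n : ℕ} (w : Fin (n + 1) → ℂ) : dhopf w 0 = 0 := by
  simpa using dhopf_smul w 0 0

section HopfDifferential

variable {n : ℕ} {w : Fin (n + 1) → ℂ}

lemma dhopf_self (hw : w ∈ antiDeSitter n) : dhopf w w = 0 := by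
  have h0 := (normSq_of_mem hw).1
  ext k; simp only [dhopf_apply, PiLp.zero_apply]; field_simp; ring

lemma cons_dhopf (h0 : w 0 ≠ 0) (z : Fin (n + 1) → ℂ) :
    (Fin.cons 0 (fun k => w 0 * dhopf w z k) : Fin (n + 1) → ℂ) = z - (z 0 / w 0) • w := by
  funext i
  refine Fin.cases ?_ (fun j => ?_) i
  · simp [h0]
  · simp only [Fin.cons_succ, dhopf_apply, Pi.sub_apply, Pi.smul_apply, smul_eq_mul]
    field_simp

/-- As ((w,w)) = -1, the right-hand side is the horizontal projection of z. -/
lemma horLift_dhopf (hw : w ∈ antiDeSitter n) (z : Fin (n + 1) → ℂ) :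
    horLift w (dhopf w z) = z + hform z w • w := by
  have h0 := (normSq_of_mem hw).1
  have h : hform w w = -1 := hw
  simp only [horLift, cons_dhopf h0, hform_sub_left, hform_smul_left, h]
  module

lemma dhopf_horLift (hw : w ∈ antiDeSitter n) (X : EuclideanSpace ℂ (Fin n)) :
    dhopf w (horLift w X) = X := by
  have h0 := (normSq_of_mem hw).1
  rw [horLift, dhopf_add, dhopf_smul, dhopf_self hw, smul_zero, add_zero]
  ext k
  simp only [dhopf_apply, Fin.cons_succ, Fin.cons_zero]
  field_simp
  ring

lemma metric_hopf (hw : w ∈ antiDeSitter n) (X Y : EuclideanSpace ℂ (Fin n)) :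
    metric (hopf w) X Y = (hform (horLift w X) (horLift w Y)).re := by
  rw [metric, hform_horLift (lift_mem (hopf_mem_ball hw)), hform_horLift hw,
    hopf_lift (hopf_mem_ball hw)]

/-- Projecting z to the horizontal space changes it by a multiple of w, which a horizontal z' does
not see. So only one of the two arguments has to be horizontal. -/
lemma metric_dhopf (hw : w ∈ antiDeSitter n) (z : Fin (n + 1) → ℂ) {z' : Fin (n + 1) → ℂ}
    (hz' : hform z' w = 0) :
    metric (hopf w) (dhopf w z) (dhopf w z') = (hform z z').re := by
  rw [metric_hopf hw, horLift_dhopf hw, horLift_dhopf hw, hz', zero_smul, add_zero,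
    hform_add_left, hform_smul_left, ← hform_conj z' w, hz', map_zero, mul_zero, add_zero]

lemma hasDerivAt_hopf {w : ℝ → Fin (n + 1) → ℂ} {w' : Fin (n + 1) → ℂ} {t : ℝ}
    (hw : HasDerivAt w w' t) (h0 : w t 0 ≠ 0) :
    HasDerivAt (fun s => hopf (w s)) (dhopf (w t) w') t := by
  suffices H : ∀ i : Fin n, HasDerivAt (fun s => w s i.succ / w s 0)
      (dhopf (w t) w' i) t from
    ((PiLp.continuousLinearEquiv 2 ℝ (fun _ : Fin n => ℂ)).symm.hasFDerivAt).comp_hasDerivAt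
      t (hasDerivAt_pi.2 H)
  intro i
  refine ((hasDerivAt_pi.1 hw i.succ).div (hasDerivAt_pi.1 hw 0) h0).congr_deriv ?_
  simp only [dhopf_apply]
  field_simp

/-- `⟨ζ, dπ z⟩ / (1 - |ζ|²)` in terms of the lift `z`. -/
lemma inner_hopf_dhopf (hw : w ∈ antiDeSitter n) (z : Fin (n + 1) → ℂ) :
    ((1 - ‖hopf w‖ ^ 2 : ℝ) : ℂ)⁻¹ * inner ℂ (hopf w) (dhopf w z) = hform z w + z 0 / w 0 := by
  obtain ⟨h0, h1⟩ := normSq_of_mem hw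
  have h : hform w w = -1 := hw
  have hX : hform (Fin.cons 0 (fun k => w 0 * dhopf w z k) : Fin (n + 1) → ℂ) w =
        (w 0 * conj (w 0)) * inner ℂ (hopf w) (dhopf w z) := by
    simp only [hform, Fin.cons_zero, Fin.cons_succ, zero_mul, neg_zero, zero_add, PiLp.inner_apply,
      RCLike.inner_apply, Finset.mul_sum, hopf, map_div₀]
    refine Finset.sum_congr rfl fun i _ => ?_
    have : conj (w 0) ≠ 0 := by simpa using h0
    field_simp
  rw [inv_eq_of_mul_eq_one_right h1, ← hX]
  rw [cons_dhopf h0, hform_sub_left, hform_smul_left, h]; ring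

/-- The Levi-Civita derivative of a vector field along a curve in terms of horizontal lifts. -/
lemma hasDerivAt_dhopf {w V : ℝ → Fin (n + 1) → ℂ} {w' V' : Fin (n + 1) → ℂ} {t : ℝ}
    (hw : HasDerivAt w w' t) (hV : HasDerivAt V V' t) (hwt : w t ∈ antiDeSitter n)
    (hVt : hform (V t) (w t) = 0) :
    HasDerivAt (fun s => dhopf (w s) (V s))
      (dhopf (w t) (V' + hform w' (w t) • V t) -
        christoffel (hopf (w t)) (dhopf (w t) w') (dhopf (w t) (V t))) t := by
  have h0 := (normSq_of_mem hwt).1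
  suffices H : ∀ i : Fin n, HasDerivAt (fun s => (V s i.succ - w s i.succ / w s 0 * V s 0) / w s 0)
      ((dhopf (w t) (V' + hform w' (w t) • V t) -
        christoffel (hopf (w t)) (dhopf (w t) w') (dhopf (w t) (V t))) i) t from
    ((PiLp.continuousLinearEquiv 2 ℝ (fun _ : Fin n => ℂ)).symm.hasFDerivAt).comp_hasDerivAt
      t (hasDerivAt_pi.2 H)
  intro i
  have hw0 := hasDerivAt_pi.1 hw 0
  have hwi := hasDerivAt_pi.1 hw i.succ
  refine (((hasDerivAt_pi.1 hV i.succ).sub ((hwi.div hw0 h0).mul (hasDerivAt_pi.1 hV 0))).div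
    hw0 h0).congr_deriv ?_
  -- Each inner product in Γ turns into ((z,w)) + z₀/w₀. The quotients match the terms from
  -- differentiating the denominators w₀; the remaining ((w',w)) V compensates for the vertical part
  -- of w', along which V would have to be rotated.
  rw [christoffel, smul_add, smul_smul, smul_smul, inner_hopf_dhopf hwt, inner_hopf_dhopf hwt, hVt]
  simp only [dhopf_apply, PiLp.sub_apply, PiLp.add_apply, PiLp.smul_apply, Pi.add_apply,
    Pi.smul_apply, smul_eq_mul, Pi.sub_apply, Pi.mul_apply, Pi.div_apply]
  field_simp
  ring

end HopfDifferential

/-! ### The group `U(1,n)` -/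

lemma hform_eq_dotProduct {n : ℕ} (a b : Fin (n + 1) → ℂ) :
    hform a b = star b ⬝ᵥ (sig n).mulVec a := by
  simp only [hform, sig, Matrix.mulVec_diagonal, dotProduct, Fin.sum_univ_succ, Fin.cons_zero,
    Fin.cons_succ, Pi.star_apply, RCLike.star_def]
  simp [mul_comm]

lemma hform_mulVec {n : ℕ} {A : Matrix (Fin (n + 1)) (Fin (n + 1)) ℂ} (hA : A ∈ U1 n)
    (a b : Fin (n + 1) → ℂ) : hform (A.mulVec a) (A.mulVec b) = hform a b := by
  have h : A.conjTranspose * sig n * A = sig n := hA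
  rw [hform_eq_dotProduct, hform_eq_dotProduct, Matrix.star_mulVec, ← Matrix.dotProduct_mulVec,
    Matrix.mulVec_mulVec, Matrix.mulVec_mulVec, h]

lemma sig_mul_sig (n : ℕ) : sig n * sig n = 1 := by
  rw [sig, Matrix.diagonal_mul_diagonal, ← Matrix.diagonal_one]
  congr 1
  funext i
  refine Fin.cases ?_ (fun j => ?_) i <;> simp

lemma mul_inv_of_mem_U1 {n : ℕ} {A : Matrix (Fin (n + 1)) (Fin (n + 1)) ℂ} (hA : A ∈ U1 n) :
    A * A⁻¹ = 1 := by
  have h : A.conjTranspose * sig n * A = sig n := hA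
  have h1 : sig n * A.conjTranspose * sig n * A = 1 := by
    rw [mul_assoc, mul_assoc, ← mul_assoc A.conjTranspose, h, sig_mul_sig]
  rw [Matrix.inv_eq_left_inv h1]
  exact mul_eq_one_comm.1 h1

lemma mulVec_mem_antiDeSitter {n : ℕ} {A : Matrix (Fin (n + 1)) (Fin (n + 1)) ℂ} (hA : A ∈ U1 n)
    {a : Fin (n + 1) → ℂ} (ha : a ∈ antiDeSitter n) : A.mulVec a ∈ antiDeSitter n :=
  (hform_mulVec hA a a).trans ha

lemma _root_.HasDerivAt.mulVec {m : ℕ} {A : ℝ → Matrix (Fin m) (Fin m) ℂ}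
    {A' : Fin m → Fin m → ℂ} {a : ℝ → Fin m → ℂ} {a' : Fin m → ℂ} {t : ℝ}
    (hA : HasDerivAt (fun s => Matrix.of.symm (A s)) A' t) (ha : HasDerivAt a a' t) :
    HasDerivAt (fun s => (A s).mulVec (a s)) ((Matrix.of A').mulVec (a t) + (A t).mulVec a') t := by
  refine hasDerivAt_pi.2 fun i => ?_
  have h := HasDerivAt.fun_sum (u := Finset.univ) fun (j : Fin m) _ =>
    (hasDerivAt_pi.1 (hasDerivAt_pi.1 hA i) j).mul (hasDerivAt_pi.1 ha j)
  refine h.congr_deriv ?_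
  simp only [Finset.sum_add_distrib]
  rfl

/-! ### Differentials and curves -/

section Curves

variable {E H M : Type*} [NormedAddCommGroup E] [NormedSpace ℝ E] [TopologicalSpace H]
  (I : ModelWithCorners ℝ E H) [TopologicalSpace M] [ChartedSpace H M]

/-- The curve through `q` which is the straight line with velocity `v` in the chart at `q`. -/
def chartCurve (q : M) (v : E) (t : ℝ) : M :=
  (extChartAt I q).symm (extChartAt I q q + t • v)

@[simp] lemma chartCurve_zero (q : M) (v : TangentSpace I q) : chartCurve I q v 0 = q := by
  have h : ∀ u : E, chartCurve I q u 0 = q := fun u => by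
    rw [chartCurve, zero_smul, add_zero, extChartAt_to_inv]
  exact h v

lemma continuousAt_chartCurve (q : M) (v : E) : ContinuousAt (chartCurve I q v) 0 := by
  have h : ContinuousAt (fun t : ℝ => extChartAt I q q + t • v) 0 := by fun_prop
  have h2 : ContinuousAt (extChartAt I q).symm (extChartAt I q q + (0 : ℝ) • v) := by
    rw [zero_smul, add_zero]
    exact continuousAt_extChartAt_symm (I := I) q
  exact ContinuousAt.comp (f := fun t : ℝ => extChartAt I q q + t • v) h2 h

variable {F : Type*} [NormedAddCommGroup F] [NormedSpace ℝ F]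

lemma exists_hasFDerivAt_comp_chart [I.Boundaryless] {f : M → F} {q : M}
    (hf : MDifferentiableAt I 𝓘(ℝ, F) f q) :
    ∃ L : E →L[ℝ] F, (∀ v : E, L v = differential I f q v) ∧
      HasFDerivAt (f ∘ (extChartAt I q).symm) L (extChartAt I q q) := by
  -- The tangent space at `q` unfolds to `E`; a copy of the derivative typed on `E` lets the vector
  -- space calculus apply.
  obtain ⟨L, hL⟩ : ∃ L : E →L[ℝ] F, L = mfderiv I 𝓘(ℝ, F) f q := ⟨_, rfl⟩
  refine ⟨L, fun v => by rw [hL]; rfl, ?_⟩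
  have h : HasFDerivWithinAt (f ∘ (extChartAt I q).symm) L (range I) (extChartAt I q q) := by
    rw [hL]; exact hf.hasMFDerivAt.2
  rwa [I.range_eq_univ, hasFDerivWithinAt_univ] at h

lemma hasDerivAt_line (y v : E) : HasDerivAt (fun t : ℝ => y + t • v) v 0 := by
  simpa using ((hasDerivAt_id (0 : ℝ)).smul_const v).const_add y

lemma hasDerivAt_comp_line {f : E → F} {L : E →L[ℝ] F} {y : E} (hf : HasFDerivAt f L y) (v : E) :
    HasDerivAt (fun t : ℝ => f (y + t • v)) (L v) 0 := by
  have e0 : y = y + (0 : ℝ) • v := by rw [zero_smul, add_zero]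
  rw [e0] at hf
  exact hf.comp_hasDerivAt (f := fun t : ℝ => y + t • v) 0 (hasDerivAt_line y v)

lemma hasDerivAt_comp_chartCurve [I.Boundaryless] {f : M → F} {q : M}
    (hf : MDifferentiableAt I 𝓘(ℝ, F) f q) (v : TangentSpace I q) :
    HasDerivAt (fun t => f (chartCurve I q v t)) (differential I f q v) 0 := by
  have h : ∀ u : E, HasDerivAt (fun t => f (chartCurve I q u t)) (differential I f q u) 0 := by
    intro u
    obtain ⟨L, hL, h⟩ := exists_hasFDerivAt_comp_chart I hf
    rw [← hL]
    exact hasDerivAt_comp_line h u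
  exact h v

variable {E' H' M' : Type*} [NormedAddCommGroup E'] [NormedSpace ℝ E'] [TopologicalSpace H']
  {I' : ModelWithCorners ℝ E' H'} [TopologicalSpace M'] [ChartedSpace H' M']

lemma differential_comp_fst {f : M → F} {q : M × M'} (hf : MDifferentiableAt I 𝓘(ℝ, F) f q.1)
    (v : TangentSpace (I.prod I') q) :
    differential (I.prod I') (fun p : M × M' => f p.1) q v =
      differential I f q.1 (mfderiv (I.prod I') I Prod.fst q v) := by
  have h := mfderiv_comp (I' := I) q hf (mdifferentiableAt_fst (I := I) (I' := I'))
  exact DFunLike.congr_fun h v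

/-- If `Re ((da, b)) = 0` then `Re ((da(Y), db(Z)))` is symmetric in `Y` and `Z`. -/
lemma re_hform_differential_symm [I.Boundaryless] [IsManifold I ∞ M] {n : ℕ}
    {a b : M → Fin (n + 1) → ℂ} (ha : ContMDiff I 𝓘(ℝ, Fin (n + 1) → ℂ) ∞ a)
    (hb : ContMDiff I 𝓘(ℝ, Fin (n + 1) → ℂ) ∞ b)
    (h : ∀ x Y, (hform (differential I a x Y) (b x)).re = 0) (x : M) (Y Z : TangentSpace I x) :
    (hform (differential I a x Y) (differential I b x Z)).re =
      (hform (differential I a x Z) (differential I b x Y)).re := by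
  set φ := extChartAt I x with hφ
  have hsm : ∀ {c : M → Fin (n + 1) → ℂ}, ContMDiff I 𝓘(ℝ, Fin (n + 1) → ℂ) ∞ c →
      ContDiffAt ℝ ∞ (c ∘ φ.symm) (φ x) := by
    intro c hc
    have h1 := (contMDiffAt_iff.1 (hc x)).2
    rw [I.range_eq_univ, contDiffWithinAt_univ] at h1
    exact h1
  have hA := hsm ha
  -- The relation is about to be differentiated, so it is needed at all chart points near `φ x`, not
  -- only at `x`.
  have hz : ∀ᶠ y in nhds (φ x), ∀ W : E, (hform (fderiv ℝ (a ∘ φ.symm) y W) ((b ∘ φ.symm) y)).re = 0 := by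
    filter_upwards [extChartAt_target_mem_nhds (I := I) x] with y hy W
    have hy1 : MDifferentiableAt 𝓘(ℝ, E) I φ.symm y :=
      ((contMDiffOn_extChartAt_symm (n := ∞) x).contMDiffAt
        ((isOpen_extChartAt_target x).mem_nhds hy)).mdifferentiableAt (by simp)
    have h1 := mfderiv_comp (I' := I) y ((ha (φ.symm y)).mdifferentiableAt (by simp)) hy1
    rw [mfderiv_eq_fderiv] at h1
    rw [h1]
    exact h (φ.symm y) _
  have hda : HasFDerivAt (fderiv ℝ (a ∘ φ.symm)) (fderiv ℝ (fderiv ℝ (a ∘ φ.symm)) (φ x)) (φ x) :=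
    (((hA.of_le (m := 2) (by norm_cast)).fderiv_right (m := 1)
      (by norm_num)).differentiableAt (by norm_num)).hasFDerivAt
  obtain ⟨A, hA', hfa⟩ := exists_hasFDerivAt_comp_chart I ((ha x).mdifferentiableAt (by simp))
  obtain ⟨B, hB', hfb⟩ := exists_hasFDerivAt_comp_chart I ((hb x).mdifferentiableAt (by simp))
  -- Derivative in the direction W of Re((Da(V), b)) = 0. The second derivative of `a` is symmetric
  -- in V and W, hence so is the other term.
  have key : ∀ V W : E, (hform (fderiv ℝ (fderiv ℝ (a ∘ φ.symm)) (φ x) W V) (b x)).re +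
      (hform (A V) (B W)).re = 0 := by
    intro V W
    have h3 := (((hasDerivAt_comp_line hda W).clm_apply (hasDerivAt_const (0 : ℝ) V)).hform
      (hasDerivAt_comp_line hfb W)).re
    have h4 : (fun t : ℝ => (hform (fderiv ℝ (a ∘ φ.symm) (φ x + t • W) V)
        ((b ∘ φ.symm) (φ x + t • W))).re) =ᶠ[nhds 0] fun _ => 0 := by
      have hc : Filter.Tendsto (fun t : ℝ => φ x + t • W) (nhds 0) (nhds (φ x)) := by
        have := (hasDerivAt_line (φ x) W).continuousAt.tendsto
        rwa [zero_smul, add_zero] at this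
      exact (hc.eventually hz).mono fun t ht => ht V
    have h5 := h3.unique ((hasDerivAt_const (0 : ℝ) (0 : ℝ)).congr_of_eventuallyEq h4)
    have hx : φ.symm (φ x) = x := extChartAt_to_inv x
    rw [zero_smul, add_zero, hfa.fderiv, map_zero, add_zero, Complex.add_re, Function.comp_apply,
      hx] at h5
    exact h5
  have hs : ∀ V W : E, fderiv ℝ (fderiv ℝ (a ∘ φ.symm)) (φ x) V W =
      fderiv ℝ (fderiv ℝ (a ∘ φ.symm)) (φ x) W V :=
    hA.isSymmSndFDerivAt (by rw [minSmoothness_of_isRCLikeNormedField]; norm_cast)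
  have hAB : ∀ V W : E, (hform (differential I a x V) (differential I b x W)).re =
      (hform (differential I a x W) (differential I b x V)).re := by
    intro V W
    have h1 := key V W
    have h2 := key W V
    rw [hs] at h2
    rw [← hA', ← hA', ← hB', ← hB']
    linarith
  exact hAB Y Z

end Curves

/-! ### The horosphere through `u` with the null vector `(1, -1, 0)` -/

/-- The null vector `(1, -1, 0)`. -/
def nullVec (k : ℕ) : Fin (k + 3) → ℂ := Fin.cons 1 (Fin.cons (-1) fun _ => 0)

/-- `horoVec` in terms of `y = λ p`. -/
def horoPoint {k : ℕ} (h : ℝ) (y : Fin (k + 1) → ℝ) : Fin (k + 3) → ℂ :=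
  Fin.cons (1 + ((y ⬝ᵥ y : ℝ) : ℂ) / 2 - Complex.I * h)
    (Fin.cons (-((y ⬝ᵥ y : ℝ) : ℂ) / 2 + Complex.I * h) fun j => (y j : ℂ))

/-- The differential of `horoPoint` at `(h, y)`, applied to `(s, c)`. -/
def horoTangent {k : ℕ} (y : Fin (k + 1) → ℝ) (s : ℝ) (c : Fin (k + 1) → ℝ) : Fin (k + 3) → ℂ :=
  Fin.cons (((y ⬝ᵥ c : ℝ) : ℂ) - Complex.I * s)
    (Fin.cons (-((y ⬝ᵥ c : ℝ) : ℂ) + Complex.I * s) fun j => (c j : ℂ))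

section Horosphere

variable {k : ℕ}

lemma sum_ofReal_mul_conj {m : ℕ} (y c : Fin m → ℝ) :
    ∑ j, (y j : ℂ) * conj (c j : ℂ) = ((y ⬝ᵥ c : ℝ) : ℂ) := by
  simp [dotProduct]

lemma hform_horoPoint_self (h : ℝ) (y : Fin (k + 1) → ℝ) :
    hform (horoPoint h y) (horoPoint h y) = -1 := by
  rw [horoPoint, hform_cons_cons, sum_ofReal_mul_conj]
  simp only [map_add, map_sub, map_mul, map_neg, map_div₀, map_one, Complex.conj_ofReal,
    Complex.conj_I, map_ofNat]
  ring

lemma hform_horoPoint_nullVec (h : ℝ) (y : Fin (k + 1) → ℝ) :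
    hform (horoPoint h y) (nullVec k) = -1 := by
  rw [horoPoint, nullVec, hform_cons_cons]
  simp only [map_neg, map_one, map_zero, mul_zero, Finset.sum_const_zero]
  ring

lemma hform_nullVec_self : hform (nullVec k) (nullVec k) = 0 := by
  rw [nullVec, hform_cons_cons]
  simp

lemma hform_horoTangent_nullVec (y : Fin (k + 1) → ℝ) (s : ℝ) (c : Fin (k + 1) → ℝ) :
    hform (horoTangent y s c) (nullVec k) = 0 := by
  rw [horoTangent, nullVec, hform_cons_cons]
  simp only [map_neg, map_one, map_zero, mul_zero, Finset.sum_const_zero]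
  ring

lemma hform_horoTangent_horoPoint (h : ℝ) (y : Fin (k + 1) → ℝ) (s : ℝ) (c : Fin (k + 1) → ℝ) :
    hform (horoTangent y s c) (horoPoint h y) = Complex.I * s := by
  rw [horoPoint, horoTangent, hform_cons_cons, sum_ofReal_mul_conj, dotProduct_comm c]
  simp only [map_add, map_sub, map_mul, map_neg, map_div₀, map_one, Complex.conj_ofReal,
    Complex.conj_I, map_ofNat]
  ring

lemma hform_horoTangent (y : Fin (k + 1) → ℝ) (s : ℝ) (c : Fin (k + 1) → ℝ) (s' : ℝ)
    (c' : Fin (k + 1) → ℝ) :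
    hform (horoTangent y s c) (horoTangent y s' c') = ((c ⬝ᵥ c' : ℝ) : ℂ) := by
  rw [horoTangent, horoTangent, hform_cons_cons, sum_ofReal_mul_conj]
  simp only [map_add, map_sub, map_mul, map_neg, Complex.conj_ofReal, Complex.conj_I]
  ring

lemma horoTangent_zero_zero (y : Fin (k + 1) → ℝ) : horoTangent y 0 0 = 0 := by
  funext i
  refine Fin.cases ?_ (fun i => Fin.cases ?_ (fun i => ?_) i) i <;> simp [horoTangent]

lemma horoTangent_one_zero (y : Fin (k + 1) → ℝ) :
    horoTangent y 1 0 = -(Complex.I • nullVec k) := by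
  funext i
  refine Fin.cases ?_ (fun i => Fin.cases ?_ (fun i => ?_) i) i <;> simp [horoTangent, nullVec]

lemma horoTangent_smul_add (y : Fin (k + 1) → ℝ) (s : ℝ) (c : Fin (k + 1) → ℝ) :
    horoTangent y s c = -(Complex.I * s) • nullVec k + horoTangent y 0 c := by
  funext i
  refine Fin.cases ?_ (fun i => Fin.cases ?_ (fun i => ?_) i) i <;>
    simp [horoTangent, nullVec] <;> ring

/-- The horizontal space at u has real dimension 2k + 4 and the T(s,c) project onto a subspace of
dimension k + 2. The k + 2 vectors ℓ - u and iT(0,e_j) span its real orthogonal complement. -/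
lemma exists_eq_of_orthogonal_horoTangent (h : ℝ) (y : Fin (k + 1) → ℝ) (ν : Fin (k + 3) → ℂ)
    (h1 : hform ν (horoPoint h y) = 0) (h2 : ∀ s c, (hform ν (horoTangent y s c)).re = 0) :
    ∃ (a : ℝ) (b : Fin (k + 1) → ℝ),
      ν = (a : ℂ) • (nullVec k - horoPoint h y) + Complex.I • horoTangent y 0 b := by
  obtain ⟨z₀, z₁, z, rfl⟩ : ∃ (z₀ z₁ : ℂ) (z : Fin (k + 1) → ℂ),
      ν = (Fin.cons z₀ (Fin.cons z₁ z) : Fin (k + 3) → ℂ) :=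
    ⟨ν 0, ν 1, fun j => ν j.succ.succ, by
      funext i
      refine Fin.cases ?_ (fun i => Fin.cases ?_ (fun i => ?_) i) i <;> simp⟩
  -- The first two entries of ℓ - u add up to -1 and those of T(0,b) to 0, so `a` can be read off
  -- from z₀ + z₁. Testing with T(1,0) shows that this sum is real, testing with T(0,e_j) gives Re
  -- z_j, and horizontality then determines z₀.
  set a : ℝ := -(z₀ + z₁).re with ha
  have him : (z₀ + z₁).im = 0 := by
    have := h2 1 0
    rw [horoTangent, hform_cons_cons] at this
    simp at this
    simpa using this
  have hz01 : z₀ + z₁ = -(a : ℂ) := by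
    apply Complex.ext <;> simp [ha]
    simpa using him
  have hre : ∀ j, (z j).re = -a * y j := by
    intro j
    have := h2 0 (Pi.single j 1)
    rw [horoTangent, hform_cons_cons] at this
    have hs : ∑ i, z i * conj (((Pi.single j (1 : ℝ) : Fin (k + 1) → ℝ) i : ℂ)) = z j := by
      rw [Finset.sum_eq_single j]
      · simp
      · intro i _ hi; simp [hi]
      · simp
    rw [hs, dotProduct_single, mul_one] at this
    simp at this
    simp only [ha, Complex.add_re]
    linarith
  have hz : ∀ j, z j = -a * y j + Complex.I * ((z j).im : ℝ) := by
    intro j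
    apply Complex.ext <;> simp [hre]
  refine ⟨a, fun j => (z j).im, ?_⟩
  have hsum : ∑ j, z j * conj (y j : ℂ) = -a * ((y ⬝ᵥ y : ℝ) : ℂ) +
      Complex.I * ((y ⬝ᵥ (fun j => (z j).im) : ℝ) : ℂ) := by
    simp only [dotProduct, Complex.ofReal_sum, Finset.mul_sum, ← Finset.sum_add_distrib]
    refine Finset.sum_congr rfl fun j _ => ?_
    conv_lhs => rw [hz j]
    simp only [Complex.conj_ofReal, Complex.ofReal_mul]
    ring
  rw [horoPoint, hform_cons_cons, hsum] at h1
  simp only [map_add, map_sub, map_mul, map_neg, map_div₀, map_one, Complex.conj_ofReal,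
    Complex.conj_I, map_ofNat] at h1
  have hz1 : z₁ = -(a : ℂ) - z₀ := by linear_combination hz01
  funext i
  refine Fin.cases ?_ (fun i => Fin.cases ?_ (fun i => ?_) i) i
  · simp only [nullVec, horoPoint, horoTangent, Pi.add_apply, Pi.sub_apply, Pi.smul_apply,
      smul_eq_mul, Fin.cons_zero, Complex.ofReal_zero]
    rw [hz1] at h1
    linear_combination -h1
  · simp only [nullVec, horoPoint, horoTangent, Pi.add_apply, Pi.sub_apply, Pi.smul_apply,
      smul_eq_mul, Fin.cons_zero, Fin.cons_succ, Complex.ofReal_zero]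
    rw [hz1] at h1 ⊢
    linear_combination h1
  · simp only [nullVec, horoPoint, horoTangent, Pi.add_apply, Pi.sub_apply, Pi.smul_apply,
      smul_eq_mul, Fin.cons_succ]
    rw [hz i]
    simp

/-! ### Pointwise algebra of CKO-forms -/

lemma ckoMatrix_mulVec_nullVec (a₀ a₁ : ℝ) (x y₀ y₁ : Fin (k + 1) → ℝ)
    (w₁ w₂ : Matrix (Fin (k + 1)) (Fin (k + 1)) ℝ) :
    (ckoMatrix a₀ a₁ x y₀ y₁ w₁ w₂).mulVec (nullVec k) =
      Fin.cons (Complex.I * ((a₀ + a₁) / 2 : ℝ)) (Fin.cons (-(Complex.I * ((a₀ + a₁) / 2 : ℝ)))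
        fun j => Complex.I * (y₀ j - y₁ j)) := by
  funext i
  refine Fin.cases ?_ (fun i => Fin.cases ?_ (fun i => ?_) i) i <;>
  simp [Matrix.mulVec, dotProduct, Fin.sum_univ_succ (n := k + 2), Fin.sum_univ_succ (n := k + 1),
    nullVec, ckoMatrix] <;> ring

lemma ckoMatrix_mulVec_single (a₀ a₁ : ℝ) (x y₀ y₁ : Fin (k + 1) → ℝ)
    (w₁ w₂ : Matrix (Fin (k + 1)) (Fin (k + 1)) ℝ) :
    (ckoMatrix a₀ a₁ x y₀ y₁ w₁ w₂).mulVec (Pi.single 0 1) =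
      Fin.cons (Complex.I * a₀) (Fin.cons (Complex.I / 2 * (a₁ - a₀))
        fun j => x j + Complex.I * y₀ j) := by
  rw [Matrix.mulVec_single_one]
  funext i
  refine Fin.cases ?_ (fun i => Fin.cases ?_ (fun i => ?_) i) i <;> simp [ckoMatrix]

/-- Ωℓ = iv with v real and ((ℓ,v)) = 0, whereas u is a real vector minus ihℓ. The real vector pairs
with iv to an imaginary number, and ℓ to zero. -/
lemma re_hform_horoPoint_ckoMatrix (a₀ a₁ : ℝ) (x y₀ y₁ : Fin (k + 1) → ℝ)
    (w₁ w₂ : Matrix (Fin (k + 1)) (Fin (k + 1)) ℝ) (h : ℝ) (y : Fin (k + 1) → ℝ) :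
    (hform (horoPoint h y) ((ckoMatrix a₀ a₁ x y₀ y₁ w₁ w₂).mulVec (nullVec k))).re = 0 := by
  rw [ckoMatrix_mulVec_nullVec, horoPoint, hform_cons_cons]
  have hs : ∀ j, (y j : ℂ) * conj (Complex.I * ((y₀ j : ℂ) - y₁ j)) =
      -Complex.I * ((y j * (y₀ j - y₁ j) : ℝ) : ℂ) := by
    intro j
    simp only [map_mul, map_sub, Complex.conj_I, Complex.conj_ofReal]
    push_cast
    ring
  simp only [hs, ← Finset.mul_sum, ← Complex.ofReal_sum]
  generalize ∑ j, y j * (y₀ j - y₁ j) = r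
  generalize (a₀ + a₁) / 2 = s
  simp

/-- Apart from the last term the value is symmetric in the two matrices. Symmetry of the whole is
therefore symmetry of y₀ ⬝ y₁', which is ᵗy₀ ∧ y₁ = 0. -/
lemma re_hform_ckoMatrix (a₀ a₁ : ℝ) (x y₀ y₁ : Fin (k + 1) → ℝ)
    (w₁ w₂ : Matrix (Fin (k + 1)) (Fin (k + 1)) ℝ) (a₀' a₁' : ℝ) (x' y₀' y₁' : Fin (k + 1) → ℝ)
    (w₁' w₂' : Matrix (Fin (k + 1)) (Fin (k + 1)) ℝ) :
    (hform ((ckoMatrix a₀ a₁ x y₀ y₁ w₁ w₂).mulVec (Pi.single 0 1))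
      ((ckoMatrix a₀' a₁' x' y₀' y₁' w₁' w₂').mulVec (nullVec k))).re =
      -((a₀ + a₁) / 2 * ((a₀' + a₁') / 2)) + y₀ ⬝ᵥ y₀' - y₀ ⬝ᵥ y₁' := by
  rw [ckoMatrix_mulVec_nullVec, ckoMatrix_mulVec_single, hform_cons_cons, Complex.add_re,
    Complex.re_sum]
  have hs : ∀ j, (((x j : ℂ) + Complex.I * y₀ j) * conj (Complex.I * ((y₀' j : ℂ) - y₁' j))).re =
      y₀ j * y₀' j - y₀ j * y₁' j := by
    intro j
    simp
    ring
  simp only [hs, Finset.sum_sub_distrib]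
  generalize (a₀' + a₁') / 2 = s
  simp [dotProduct]
  ring

/-- The components of a matrix of the Lie algebra of `U(1,n)` for which the normal vectors
`nullVec - u` are orthogonal to all `Ω u`. -/
lemma eq_ckoMatrix {Ω : Matrix (Fin (k + 3)) (Fin (k + 3)) ℂ}
    (hskew : ∀ a b, hform (Ω.mulVec a) b + hform a (Ω.mulVec b) = 0)
    (hort : ∀ (h l : ℝ) (j : Fin (k + 1)), 0 < l →
      (hform (horoPoint h (Pi.single j l)) (Ω.mulVec (nullVec k))).re = 0) :
    ((Matrix.of fun i j : Fin (k + 1) => (Ω i.succ.succ j.succ.succ).re).transpose =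
        -(Matrix.of fun i j : Fin (k + 1) => (Ω i.succ.succ j.succ.succ).re) ∧
      (Matrix.of fun i j : Fin (k + 1) => (Ω i.succ.succ j.succ.succ).im).transpose =
        (Matrix.of fun i j : Fin (k + 1) => (Ω i.succ.succ j.succ.succ).im)) ∧
    Ω = ckoMatrix (Ω 0 0).im (Ω 1 1).im (fun j => (Ω j.succ.succ 0).re)
      (fun j => (Ω j.succ.succ 0).im) (fun j => (Ω j.succ.succ 1).im)
      (Matrix.of fun i j => (Ω i.succ.succ j.succ.succ).re)
      (Matrix.of fun i j => (Ω i.succ.succ j.succ.succ).im) := by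
  -- Pairing with basis vectors turns `hskew` into relations between entries of Ω.
  have e0 : ∀ z : Fin (k + 3) → ℂ, hform z (Pi.single 0 1) = -z 0 := by
    intro z
    simp [hform, Fin.succ_ne_zero]
  have es : ∀ (z : Fin (k + 3) → ℂ) (j : Fin (k + 2)), hform z (Pi.single j.succ 1) = z j.succ := by
    intro z j
    rw [hform, Finset.sum_eq_single j]
    · simp [(Fin.succ_ne_zero j).symm]
    · intro i _ hi; simp [hi]
    · simp
  have e0' : ∀ z : Fin (k + 3) → ℂ, hform (Pi.single 0 1) z = -conj (z 0) := by
    intro z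
    rw [← hform_conj, e0, map_neg]
  have es' : ∀ (z : Fin (k + 3) → ℂ) (j : Fin (k + 2)),
      hform (Pi.single j.succ 1) z = conj (z j.succ) := by
    intro z j
    rw [← hform_conj, es]
  have s00 : Ω 0 0 + conj (Ω 0 0) = 0 := by
    have := hskew (Pi.single 0 1) (Pi.single 0 1)
    rw [e0, e0', Matrix.mulVec_single_one] at this
    simp only [Matrix.col_apply] at this
    linear_combination -this
  have s0s : ∀ j : Fin (k + 2), Ω 0 j.succ = conj (Ω j.succ 0) := by
    intro j
    have := hskew (Pi.single j.succ 1) (Pi.single 0 1)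
    rw [e0, es', Matrix.mulVec_single_one, Matrix.mulVec_single_one] at this
    simp only [Matrix.col_apply] at this
    linear_combination -this
  have sss : ∀ i j : Fin (k + 2), Ω i.succ j.succ = -conj (Ω j.succ i.succ) := by
    intro i j
    have := hskew (Pi.single j.succ 1) (Pi.single i.succ 1)
    rw [es, es', Matrix.mulVec_single_one, Matrix.mulVec_single_one] at this
    simp only [Matrix.col_apply] at this
    linear_combination this
  have hnull : Ω.mulVec (nullVec k) = fun i => Ω i 0 - Ω i 1 := by
    funext i
    simp [Matrix.mulVec, dotProduct, Fin.sum_univ_succ (n := k + 2),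
      Fin.sum_univ_succ (n := k + 1), nullVec]
    ring
  have hcons : (fun i => Ω i 0 - Ω i 1) = (Fin.cons (Ω 0 0 - Ω 0 1) (Fin.cons (Ω 1 0 - Ω 1 1)
      fun j => Ω j.succ.succ 0 - Ω j.succ.succ 1) : Fin (k + 3) → ℂ) := by
    funext i
    refine Fin.cases ?_ (fun i => Fin.cases ?_ (fun i => ?_) i) i <;> simp
  have r00 : (Ω 0 0).re = 0 := by
    have := congrArg Complex.re s00
    simp at this
    linarith
  have s01 : Ω 0 1 = conj (Ω 1 0) := s0s 0
  have s11 : (Ω 1 1).re = 0 := by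
    have := congrArg Complex.re (sss 0 0)
    simp at this
    linarith
  -- The λ² terms cancel because Re Ω₀₁ = Re Ω₁₀. What is left is affine in h and in λ, so a few
  -- sample points with λ > 0 make each coefficient vanish.
  have hlin : ∀ (h l : ℝ) (j : Fin (k + 1)), 0 < l →
      (Ω 1 0).re + l * ((Ω j.succ.succ 0).re - (Ω j.succ.succ 1).re) +
        h * ((Ω 0 0).im - (Ω 1 1).im + 2 * (Ω 1 0).im) = 0 := by
    intro h l j hl
    have := hort h l j hl
    rw [hnull, hcons, horoPoint, hform_cons_cons, Complex.add_re, Complex.re_sum,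
      Finset.sum_eq_single j] at this
    · rw [s01] at this
      simp [r00, s11] at this
      linarith
    · intro i _ hi
      simp [hi]
    · simp
  have c10 : (Ω 1 0).re = 0 := by linarith [hlin 0 1 0 one_pos, hlin 0 2 0 two_pos]
  have cim : 2 * (Ω 1 0).im = (Ω 1 1).im - (Ω 0 0).im := by
    linarith [hlin 0 1 0 one_pos, hlin 1 1 0 one_pos]
  have cj : ∀ j : Fin (k + 1), (Ω j.succ.succ 1).re = (Ω j.succ.succ 0).re := by
    intro j
    linarith [hlin 0 1 j one_pos]
  refine ⟨⟨?_, ?_⟩, ?_⟩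
  · ext i j
    simp [sss j.succ i.succ]
  · ext i j
    simp [sss j.succ i.succ]
  · ext i j
    refine Fin.cases ?_ (fun i => Fin.cases ?_ (fun i => ?_) i) i <;>
      refine Fin.cases ?_ (fun j => Fin.cases ?_ (fun j => ?_) j) j
    · apply Complex.ext <;> simp [ckoMatrix, r00]
    · change Ω 0 1 = _
      rw [s01]
      apply Complex.ext <;> simp [ckoMatrix, c10]
      linarith
    · rw [s0s]
      apply Complex.ext <;> simp [ckoMatrix]
    · change Ω 1 0 = _
      apply Complex.ext <;> simp [ckoMatrix, c10]
      linarith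
    · change Ω 1 1 = _
      apply Complex.ext <;> simp [ckoMatrix, s11]
    · rw [sss]
      change -conj (Ω j.succ.succ 1) = _
      apply Complex.ext <;> simp [ckoMatrix, cj]
    · apply Complex.ext <;> simp [ckoMatrix]
    · change Ω i.succ.succ 1 = _
      apply Complex.ext <;> simp [ckoMatrix, cj]
    · apply Complex.ext <;> simp [ckoMatrix]

end Horosphere

/-! ### Real linearity of the metric and of the covariant derivative -/

section Linear

variable {n : ℕ}

lemma horLift_add (w : Fin (n + 1) → ℂ) (X Y : EuclideanSpace ℂ (Fin n)) :
    horLift w (X + Y) = horLift w X + horLift w Y := by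
  have h : (Fin.cons 0 (fun k => w 0 * (X + Y) k) : Fin (n + 1) → ℂ) =
      (Fin.cons 0 (fun k => w 0 * X k) : Fin (n + 1) → ℂ) + Fin.cons 0 (fun k => w 0 * Y k) := by
    funext i
    refine Fin.cases ?_ (fun j => ?_) i <;> simp [mul_add]
  simp only [horLift, h, hform_add_left]
  module

lemma horLift_smul (w : Fin (n + 1) → ℂ) (c : ℂ) (X : EuclideanSpace ℂ (Fin n)) :
    horLift w (c • X) = c • horLift w X := by
  have h : (Fin.cons 0 (fun k => w 0 * (c • X) k) : Fin (n + 1) → ℂ) =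
      c • (Fin.cons 0 (fun k => w 0 * X k) : Fin (n + 1) → ℂ) := by
    funext i
    refine Fin.cases ?_ (fun j => ?_) i <;> simp [mul_left_comm]
  simp only [horLift, h, hform_smul_left]
  module

/-- The linear functional `⟨·, Y⟩`. -/
def metricLeft (ζ Y : EuclideanSpace ℂ (Fin n)) : EuclideanSpace ℂ (Fin n) →ₗ[ℝ] ℝ where
  toFun X := metric ζ X Y
  map_add' X X' := by simp only [metric, horLift_add, hform_add_left, Complex.add_re]
  map_smul' c X := by
    rw [← Complex.coe_smul]
    simp only [metric, horLift_smul, hform_smul_left, Complex.re_ofReal_mul, RingHom.id_apply,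
      smul_eq_mul]

variable {E H M : Type*} [NormedAddCommGroup E] [NormedSpace ℝ E] [TopologicalSpace H]
  (I : ModelWithCorners ℝ E H) [TopologicalSpace M] [ChartedSpace H M]

/-- `covDeriv` as a linear map. -/
def covDerivLinear (Ψ V : M → EuclideanSpace ℂ (Fin n)) (q : M) :
    TangentSpace I q →ₗ[ℝ] EuclideanSpace ℂ (Fin n) where
  toFun := covDeriv I Ψ V q
  map_add' v v' := by
    simp only [covDeriv, christoffel, map_add, inner_add_right]
    module
  map_smul' c v := by
    simp only [covDeriv, christoffel, map_smul, RingHom.id_apply, ← Complex.coe_smul,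
      inner_smul_right]
    module

/-- Differentials and Levi-Civita derivatives in terms of lifts to `H₁^{2n+1}` along a curve. -/
lemma differential_hopf_eq [I.Boundaryless] {Ψ : M → EuclideanSpace ℂ (Fin n)} {q : M}
    (hΨ : MDifferentiableAt I 𝓘(ℝ, EuclideanSpace ℂ (Fin n)) Ψ q) {v : TangentSpace I q}
    {w : ℝ → Fin (n + 1) → ℂ} {w' : Fin (n + 1) → ℂ} (hw : HasDerivAt w w' 0)
    (hw0 : w 0 ∈ antiDeSitter n) (hwΨ : ∀ t, Ψ (chartCurve I q v t) = hopf (w t)) :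
    differential I Ψ q v = dhopf (w 0) w' := by
  refine (hasDerivAt_comp_chartCurve I hΨ v).unique ?_
  simp only [hwΨ]
  exact hasDerivAt_hopf hw (normSq_of_mem hw0).1

/-- The Christoffel term produced by `hasDerivAt_dhopf` cancels the one in `covDeriv`, and only data
upstairs remain. -/
lemma covDeriv_eq [I.Boundaryless] {Ψ N : M → EuclideanSpace ℂ (Fin n)} {q : M}
    (hΨ : MDifferentiableAt I 𝓘(ℝ, EuclideanSpace ℂ (Fin n)) Ψ q)
    (hN : MDifferentiableAt I 𝓘(ℝ, EuclideanSpace ℂ (Fin n)) N q) {v : TangentSpace I q}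
    {w V : ℝ → Fin (n + 1) → ℂ} {w' V' : Fin (n + 1) → ℂ} (hw : HasDerivAt w w' 0)
    (hV : HasDerivAt V V' 0) (hw0 : w 0 ∈ antiDeSitter n) (hV0 : hform (V 0) (w 0) = 0)
    (hwΨ : ∀ t, Ψ (chartCurve I q v t) = hopf (w t))
    (hVN : ∀ᶠ t in nhds 0, N (chartCurve I q v t) = dhopf (w t) (V t)) :
    covDeriv I Ψ N q v = dhopf (w 0) (V' + hform w' (w 0) • V 0) := by
  have h1 := (hasDerivAt_comp_chartCurve I hN v).unique
    ((hasDerivAt_dhopf hw hV hw0 hV0).congr_of_eventuallyEq hVN)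
  have h2 := hVN.self_of_nhds
  have h3 := hwΨ 0
  rw [chartCurve_zero] at h2 h3
  rw [covDeriv, h1, differential_hopf_eq I hΨ hw hw0 hwΨ, h2, h3, sub_add_cancel]

end Linear

/-! ### ### Factoring through a hyperplane -/

/-- By dimension the range of f is the whole hyperplane ker φ, which contains the range of B. With f
= dΨ, B = -∇N and φ = ⟨·, N⟩ this yields the shape operator. -/
lemma _root_.LinearMap.exists_lift_of_finrank {T W : Type*} [AddCommGroup T] [Module ℝ T]
    [AddCommGroup W] [Module ℝ W] [FiniteDimensional ℝ W] {f B : T →ₗ[ℝ] W} {φ : W →ₗ[ℝ] ℝ}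
    (hf : Function.Injective f) (hφ : φ ≠ 0) (hφf : ∀ v, φ (f v) = 0) (hφB : ∀ v, φ (B v) = 0)
    (hdim : Module.finrank ℝ T + 1 = Module.finrank ℝ W) :
    ∃ A : Module.End ℝ T, ∀ v, f (A v) = B v := by
  have hr : LinearMap.range f = LinearMap.ker φ := by
    refine Submodule.eq_of_le_of_finrank_eq ?_ ?_
    · rintro _ ⟨v, rfl⟩
      exact hφf v
    · have h1 := LinearMap.finrank_range_of_inj hf
      have h2 := Module.Dual.finrank_ker_add_one_of_ne_zero hφ
      omega
  obtain ⟨f', hf'⟩ := f.exists_leftInverse_of_injective (LinearMap.ker_eq_bot.2 hf)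
  refine ⟨f' ∘ₗ B, fun v => ?_⟩
  obtain ⟨u, hu⟩ : B v ∈ LinearMap.range f := hr ▸ hφB v
  have h := LinearMap.congr_fun hf' u
  simp only [LinearMap.comp_apply, LinearMap.id_apply] at h ⊢
  rw [← hu, h]

/-! ### The Maurer-Cartan form -/

section MaurerCartan

variable {k : ℕ} {G : Type*} [TopologicalSpace G]
  [ChartedSpace (EuclideanSpace ℝ (Fin (k + 1))) G]
  {g : G → Matrix (Fin (k + 3)) (Fin (k + 3)) ℂ}

lemma mulVec_differential_entries (hgU : ∀ x, g x ∈ U1 (k + 2)) (x : G)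
    (Y : TangentSpace (𝓡 (k + 1)) x) (a : Fin (k + 3) → ℂ) :
    (Matrix.of (differential (𝓡 (k + 1)) (entries g) x Y)).mulVec a =
      (g x).mulVec ((maurerCartan g x Y).mulVec a) := by
  have h : maurerCartan g x Y = (g x)⁻¹ * Matrix.of (differential (𝓡 (k + 1)) (entries g) x Y) :=
    rfl
  rw [h, Matrix.mulVec_mulVec, ← mul_assoc, mul_inv_of_mem_U1 (hgU x), one_mul]

lemma contMDiff_mulVec {E H M : Type*} [NormedAddCommGroup E] [NormedSpace ℝ E] [TopologicalSpace H]
    {I : ModelWithCorners ℝ E H} [TopologicalSpace M] [ChartedSpace H M]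
    {A : M → Matrix (Fin (k + 3)) (Fin (k + 3)) ℂ}
    (hA : ContMDiff I 𝓘(ℝ, Fin (k + 3) → Fin (k + 3) → ℂ) ∞ fun x => Matrix.of.symm (A x))
    (a : Fin (k + 3) → ℂ) :
    ContMDiff I 𝓘(ℝ, Fin (k + 3) → ℂ) ∞ fun x => (A x).mulVec a := by
  have h : ContDiff ℝ ∞ fun B : Fin (k + 3) → Fin (k + 3) → ℂ => (Matrix.of B).mulVec a := by
    refine contDiff_pi.2 fun i => ?_
    simp only [Matrix.mulVec, dotProduct, Matrix.of_apply]
    fun_prop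
  exact h.comp_contMDiff hA

lemma differential_mulVec (hgU : ∀ x, g x ∈ U1 (k + 2))
    (hg : ContMDiff (𝓡 (k + 1)) 𝓘(ℝ, Fin (k + 3) → Fin (k + 3) → ℂ) ∞ (entries g)) (x : G)
    (Y : TangentSpace (𝓡 (k + 1)) x) (a : Fin (k + 3) → ℂ) :
    differential (𝓡 (k + 1)) (fun x => (g x).mulVec a) x Y =
      (g x).mulVec ((maurerCartan g x Y).mulVec a) := by
  have h1 := hasDerivAt_comp_chartCurve (𝓡 (k + 1))
    ((contMDiff_mulVec hg a x).mdifferentiableAt (by simp)) Y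
  have h2 := HasDerivAt.mulVec (hasDerivAt_comp_chartCurve (𝓡 (k + 1))
    ((hg x).mdifferentiableAt (by simp)) Y) (hasDerivAt_const (0 : ℝ) a)
  rw [h1.unique h2, Matrix.mulVec_zero, add_zero, mulVec_differential_entries hgU]

/-- Derivative of the constant function ((ga, gb)) = ((a, b)). -/
lemma maurerCartan_skew (hgU : ∀ x, g x ∈ U1 (k + 2))
    (hg : ContMDiff (𝓡 (k + 1)) 𝓘(ℝ, Fin (k + 3) → Fin (k + 3) → ℂ) ∞ (entries g)) (x : G)
    (Y : TangentSpace (𝓡 (k + 1)) x) (a b : Fin (k + 3) → ℂ) :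
    hform ((maurerCartan g x Y).mulVec a) b + hform a ((maurerCartan g x Y).mulVec b) = 0 := by
  have h := fun c => hasDerivAt_comp_chartCurve (𝓡 (k + 1))
    ((contMDiff_mulVec hg c x).mdifferentiableAt (by simp)) Y
  have h1 := (h a).hform (h b)
  simp only [hform_mulVec (hgU _), chartCurve_zero, differential_mulVec hgU hg] at h1
  exact h1.unique (hasDerivAt_const _ _)

lemma maurerCartan_re_self (hgU : ∀ x, g x ∈ U1 (k + 2))
    (hg : ContMDiff (𝓡 (k + 1)) 𝓘(ℝ, Fin (k + 3) → Fin (k + 3) → ℂ) ∞ (entries g)) (x : G)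
    (Y : TangentSpace (𝓡 (k + 1)) x) (a : Fin (k + 3) → ℂ) :
    (hform ((maurerCartan g x Y).mulVec a) a).re = 0 := by
  have h := congrArg Complex.re (maurerCartan_skew hgU hg x Y a a)
  rw [Complex.add_re, hform_re_comm a, Complex.zero_re] at h
  linarith

/-- `Ω` is a CKO-form if the vectors `nullVec - u` are orthogonal to all `Ω u`. -/
lemma isCKO_of_orthogonal [IsManifold (𝓡 (k + 1)) ∞ G] (hgU : ∀ x, g x ∈ U1 (k + 2))
    (hg : ContMDiff (𝓡 (k + 1)) 𝓘(ℝ, Fin (k + 3) → Fin (k + 3) → ℂ) ∞ (entries g))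
    (h : ∀ x (Y : TangentSpace (𝓡 (k + 1)) x) (h l : ℝ) (j : Fin (k + 1)), 0 < l →
      (hform (horoPoint h (Pi.single j l)) ((maurerCartan g x Y).mulVec (nullVec k))).re = 0) :
    IsCKO (maurerCartan g) := by
  have hc := fun x (Y : TangentSpace (𝓡 (k + 1)) x) =>
    eq_ckoMatrix (maurerCartan_skew hgU hg x Y) (h x Y)
  refine ⟨fun x =>
    { toFun := fun Y => (maurerCartan g x Y 0 0).im
      map_add' := fun _ _ => by simp
      map_smul' := fun _ _ => by simp }, fun x =>
    { toFun := fun Y => (maurerCartan g x Y 1 1).im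
      map_add' := fun _ _ => by simp
      map_smul' := fun _ _ => by simp }, fun x =>
    { toFun := fun Y j => (maurerCartan g x Y j.succ.succ 0).re
      map_add' := fun _ _ => by ext; simp
      map_smul' := fun _ _ => by ext; simp }, fun x =>
    { toFun := fun Y j => (maurerCartan g x Y j.succ.succ 0).im
      map_add' := fun _ _ => by ext; simp
      map_smul' := fun _ _ => by ext; simp }, fun x =>
    { toFun := fun Y j => (maurerCartan g x Y j.succ.succ 1).im
      map_add' := fun _ _ => by ext; simp
      map_smul' := fun _ _ => by ext; simp }, fun x =>
    { toFun := fun Y => Matrix.of fun i j => (maurerCartan g x Y i.succ.succ j.succ.succ).re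
      map_add' := fun _ _ => by ext; simp
      map_smul' := fun _ _ => by ext; simp }, fun x =>
    { toFun := fun Y => Matrix.of fun i j => (maurerCartan g x Y i.succ.succ j.succ.succ).im
      map_add' := fun _ _ => by ext; simp
      map_smul' := fun _ _ => by ext; simp }, fun x Y => (hc x Y).1, fun x Y => (hc x Y).2, ?_⟩
  -- The pair ge₀, gℓ satisfies Re((d(ge₀), gℓ)) = 0, since ((Ωe₀, ℓ)) is imaginary for a matrix of
  -- CKO shape.
  intro x Y Z
  have hs := re_hform_differential_symm (𝓡 (k + 1)) (contMDiff_mulVec hg (Pi.single 0 1))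
    (contMDiff_mulVec hg (nullVec k)) (fun x Y => ?_) x Y Z
  · simp only [differential_mulVec hgU hg, hform_mulVec (hgU _)] at hs
    rw [(hc x Y).2, (hc x Z).2, re_hform_ckoMatrix, re_hform_ckoMatrix] at hs
    have hcomm := dotProduct_comm (fun j : Fin (k + 1) => (maurerCartan g x Y j.succ.succ 0).im)
      (fun j => (maurerCartan g x Z j.succ.succ 0).im)
    simp only [LinearMap.coe_mk, AddHom.coe_mk]
    linarith
  · rw [differential_mulVec hgU hg, hform_mulVec (hgU _), (hc x Y).2, ckoMatrix_mulVec_single,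
      nullVec, hform_cons_cons]
    simp

end MaurerCartan

/-! ### The hypersurface `Ψ_g` -/

section Hyper

variable {k : ℕ} {G : Type*}

/-- The coordinate `y = λ p` on `G × ℝ × ℝ × S^{n-2}`. -/
def radial (q : G × ℝ × ℝ × Sph k) : Fin (k + 1) → ℝ := fun j => q.2.2.1 * q.2.2.2.1 j

lemma PsiTilde_one (g : G → Matrix (Fin (k + 3)) (Fin (k + 3)) ℂ) (q : G × ℝ × ℝ × Sph k) :
    PsiTilde g (1, q) = (g q.1).mulVec (horoPoint q.2.1 (radial q)) := by
  have hn : ∑ j, q.2.2.2.1 j * q.2.2.2.1 j = 1 := by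
    have h1 : ‖q.2.2.2.1‖ = 1 := by simp
    have h2 := EuclideanSpace.real_norm_sq_eq q.2.2.2.1
    rw [h1] at h2
    simpa [sq] using h2.symm
  have h : radial q ⬝ᵥ radial q = q.2.2.1 ^ 2 := by
    have : radial q ⬝ᵥ radial q = q.2.2.1 ^ 2 * ∑ j, q.2.2.2.1 j * q.2.2.2.1 j := by
      rw [Finset.mul_sum]
      exact Finset.sum_congr rfl fun j _ => by simp only [radial]; ring
    rw [this, hn, mul_one]
  rw [PsiTilde, horoVec, horoPoint, h]
  simp [radial]

lemma PsiTilde_mem {g : G → Matrix (Fin (k + 3)) (Fin (k + 3)) ℂ} (hgU : ∀ x, g x ∈ U1 (k + 2))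
    (q : G × ℝ × ℝ × Sph k) : PsiTilde g (1, q) ∈ antiDeSitter (k + 2) := by
  rw [PsiTilde_one]
  exact mulVec_mem_antiDeSitter (hgU _) (hform_horoPoint_self _ _)

lemma hasDerivAt_horoPoint {h : ℝ → ℝ} {y : ℝ → Fin (k + 1) → ℝ} {h' : ℝ} {y' : Fin (k + 1) → ℝ}
    {t : ℝ} (hh : HasDerivAt h h' t) (hy : HasDerivAt y y' t) :
    HasDerivAt (fun s => horoPoint (h s) (y s)) (horoTangent (y t) h' y') t := by
  have hyy : HasDerivAt (fun s => ((y s ⬝ᵥ y s : ℝ) : ℂ) / 2) ((y t ⬝ᵥ y' : ℝ) : ℂ) t := by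
    have h1 := HasDerivAt.fun_sum (u := Finset.univ) fun (j : Fin (k + 1)) _ =>
      (hasDerivAt_pi.1 hy j).mul (hasDerivAt_pi.1 hy j)
    refine (h1.ofReal_comp.div_const 2).congr_deriv ?_
    have : ∑ j, (y' j * y t j + y t j * y' j) = 2 * (y t ⬝ᵥ y') := by
      rw [dotProduct, Finset.mul_sum]
      exact Finset.sum_congr rfl fun j _ => by ring
    rw [this]
    push_cast
    ring
  have hI := hh.ofReal_comp.const_mul Complex.I
  refine hasDerivAt_pi.2 fun i => ?_
  refine Fin.cases ?_ (fun i => Fin.cases ?_ (fun i => ?_) i) i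
  · exact (hyy.const_add 1).sub hI
  · refine (hyy.neg.add hI).congr_of_eventuallyEq (Filter.Eventually.of_forall fun s => ?_)
    simp [horoPoint, neg_div]
  · exact (hasDerivAt_pi.1 hy i).ofReal_comp

variable [TopologicalSpace G] [ChartedSpace (EuclideanSpace ℝ (Fin (k + 1))) G]
  {g : G → Matrix (Fin (k + 3)) (Fin (k + 3)) ℂ}

lemma contMDiff_radial :
    ContMDiff (modelM k) 𝓘(ℝ, Fin (k + 1) → ℝ) ∞ (radial : G × ℝ × ℝ × Sph k → _) := by
  have h1 : ContMDiff (modelM k) 𝓘(ℝ, ℝ) ∞ fun q : G × ℝ × ℝ × Sph k => q.2.2.1 :=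
    contMDiff_fst.comp (contMDiff_snd.comp contMDiff_snd)
  have h3 : ContMDiff (𝓡 k) 𝓘(ℝ, EuclideanSpace ℝ (Fin (k + 1))) ∞ fun p : Sph k => p.1 :=
    have := Fact.mk (finrank_euclideanSpace_fin (𝕜 := ℝ) (n := k + 1))
    contMDiff_coe_sphere
  have h2 : ContMDiff (modelM k) 𝓘(ℝ, EuclideanSpace ℝ (Fin (k + 1))) ∞
      fun q : G × ℝ × ℝ × Sph k => q.2.2.2.1 :=
    h3.comp (contMDiff_snd.comp (contMDiff_snd.comp contMDiff_snd))
  exact (PiLp.continuousLinearEquiv 2 ℝ (fun _ : Fin (k + 1) => ℝ)).contDiff.comp_contMDiff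
    (h1.smul h2)

lemma contMDiff_height :
    ContMDiff (modelM k) 𝓘(ℝ, ℝ) ∞ fun q : G × ℝ × ℝ × Sph k => q.2.1 :=
  contMDiff_fst.comp contMDiff_snd

/-- The differential of `(x, h, λ, p) ↦ (x, h, λ p)` at `q`. -/
def coordDeriv (q : G × ℝ × ℝ × Sph k) :
    TangentSpace (modelM k) q →ₗ[ℝ] TangentSpace (𝓡 (k + 1)) q.1 × ℝ × (Fin (k + 1) → ℝ) :=
  (mfderiv (modelM k) (𝓡 (k + 1)) Prod.fst q).toLinearMap.prod
    ((differential (modelM k) (fun q : G × ℝ × ℝ × Sph k => q.2.1) q).prod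
      (differential (modelM k) radial q))

lemma hasDerivAt_PsiTilde (hgU : ∀ x, g x ∈ U1 (k + 2))
    (hg : ContMDiff (𝓡 (k + 1)) 𝓘(ℝ, Fin (k + 3) → Fin (k + 3) → ℂ) ∞ (entries g))
    (q : G × ℝ × ℝ × Sph k) (v : TangentSpace (modelM k) q) :
    HasDerivAt (fun t => PsiTilde g (1, chartCurve (modelM k) q v t))
      ((g q.1).mulVec ((maurerCartan g q.1 (coordDeriv q v).1).mulVec
        (horoPoint q.2.1 (radial q)) +
        horoTangent (radial q) (coordDeriv q v).2.1 (coordDeriv q v).2.2)) 0 := by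
  simp only [PsiTilde_one]
  have h1 := hasDerivAt_comp_chartCurve (modelM k)
    (((hg.comp contMDiff_fst) q).mdifferentiableAt (by simp)) v
  have h2 := hasDerivAt_horoPoint
    (hasDerivAt_comp_chartCurve (modelM k) ((contMDiff_height q).mdifferentiableAt (by simp)) v)
    (hasDerivAt_comp_chartCurve (modelM k) ((contMDiff_radial q).mdifferentiableAt (by simp)) v)
  have h3 := HasDerivAt.mulVec h1 h2
  rw [chartCurve_zero] at h3
  refine h3.congr_deriv ?_
  have h4 := differential_comp_fst (I' := 𝓘(ℝ, ℝ).prod (𝓘(ℝ, ℝ).prod (𝓡 k))) (𝓡 (k + 1))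
    (f := entries g) (q := q) ((hg q.1).mdifferentiableAt (by simp)) v
  have h5 : differential (modelM k) (entries g ∘ Prod.fst) q v =
      differential (𝓡 (k + 1)) (entries g) q.1 (coordDeriv q v).1 := h4
  rw [h5, mulVec_differential_entries hgU, Matrix.mulVec_add]
  rfl

lemma hasDerivAt_mulVec_fst (hgU : ∀ x, g x ∈ U1 (k + 2))
    (hg : ContMDiff (𝓡 (k + 1)) 𝓘(ℝ, Fin (k + 3) → Fin (k + 3) → ℂ) ∞ (entries g))
    (q : G × ℝ × ℝ × Sph k) (v : TangentSpace (modelM k) q) (a : Fin (k + 3) → ℂ) :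
    HasDerivAt (fun t => (g (chartCurve (modelM k) q v t).1).mulVec a)
      ((g q.1).mulVec ((maurerCartan g q.1 (coordDeriv q v).1).mulVec a)) 0 := by
  have h1 := hasDerivAt_comp_chartCurve (modelM k)
    (((hg.comp contMDiff_fst) q).mdifferentiableAt (by simp)) v
  have h3 := HasDerivAt.mulVec h1 (hasDerivAt_const (0 : ℝ) a)
  refine h3.congr_deriv ?_
  have h4 := differential_comp_fst (I' := 𝓘(ℝ, ℝ).prod (𝓘(ℝ, ℝ).prod (𝓡 k))) (𝓡 (k + 1))
    (f := entries g) (q := q) ((hg q.1).mdifferentiableAt (by simp)) v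
  have h5 : differential (modelM k) (entries g ∘ Prod.fst) q v =
      differential (𝓡 (k + 1)) (entries g) q.1 (coordDeriv q v).1 := h4
  rw [h5, mulVec_differential_entries hgU, Matrix.mulVec_zero, add_zero]

lemma finrank_tangentSpace (q : G × ℝ × ℝ × Sph k) :
    Module.finrank ℝ (TangentSpace (modelM k) q) = 2 * k + 3 := by
  change Module.finrank ℝ (EuclideanSpace ℝ (Fin (k + 1)) × ℝ × ℝ × EuclideanSpace ℝ (Fin k)) = _
  simp
  ring

lemma mdifferentiableAt_PsiG (hPsi : IsImmersionOn (modelM k) (PsiG g) (domM k G))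
    {q : G × ℝ × ℝ × Sph k} (hq : q ∈ domM k G) :
    MDifferentiableAt (modelM k) 𝓘(ℝ, EuclideanSpace ℂ (Fin (k + 2))) (PsiG g) q :=
  (hPsi.1.contMDiffAt ((isOpen_domM k G).mem_nhds hq)).mdifferentiableAt (by simp)

lemma differential_PsiG (hgU : ∀ x, g x ∈ U1 (k + 2))
    (hg : ContMDiff (𝓡 (k + 1)) 𝓘(ℝ, Fin (k + 3) → Fin (k + 3) → ℂ) ∞ (entries g))
    (hPsi : IsImmersionOn (modelM k) (PsiG g) (domM k G)) {q : G × ℝ × ℝ × Sph k}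
    (hq : q ∈ domM k G) (v : TangentSpace (modelM k) q) :
    differential (modelM k) (PsiG g) q v = dhopf (PsiTilde g (1, q))
      ((g q.1).mulVec ((maurerCartan g q.1 (coordDeriv q v).1).mulVec
        (horoPoint q.2.1 (radial q)) +
        horoTangent (radial q) (coordDeriv q v).2.1 (coordDeriv q v).2.2)) := by
  have h := differential_hopf_eq (modelM k) (mdifferentiableAt_PsiG hPsi hq)
    (hasDerivAt_PsiTilde hgU hg q v) (PsiTilde_mem hgU _) fun t => rfl
  rwa [chartCurve_zero] at h

/-- dΨ factors through `coordDeriv q`, which is thus injective when dΨ is; both sides have dimension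
2k + 3. Consequently any triple (Y, s, c) is realised by a tangent vector, and polar coordinates
need no separate treatment. -/
lemma bijective_coordDeriv (hgU : ∀ x, g x ∈ U1 (k + 2))
    (hg : ContMDiff (𝓡 (k + 1)) 𝓘(ℝ, Fin (k + 3) → Fin (k + 3) → ℂ) ∞ (entries g))
    (hPsi : IsImmersionOn (modelM k) (PsiG g) (domM k G)) {q : G × ℝ × ℝ × Sph k}
    (hq : q ∈ domM k G) : Function.Bijective (coordDeriv q) := by
  have hinj : Function.Injective (coordDeriv q) := by
    rw [← LinearMap.ker_eq_bot, LinearMap.ker_eq_bot']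
    intro v hv
    refine hPsi.2 q hq ?_
    rw [differential_PsiG hgU hg hPsi hq, hv, map_zero]
    simp [horoTangent_zero_zero]
  have : FiniteDimensional ℝ (TangentSpace (modelM k) q) := inferInstanceAs
    (FiniteDimensional ℝ (EuclideanSpace ℝ (Fin (k + 1)) × ℝ × ℝ × EuclideanSpace ℝ (Fin k)))
  have : FiniteDimensional ℝ (TangentSpace (𝓡 (k + 1)) q.1) := inferInstanceAs
    (FiniteDimensional ℝ (EuclideanSpace ℝ (Fin (k + 1))))
  refine ⟨hinj, (LinearMap.injective_iff_surjective_of_finrank_eq_finrank ?_).1 hinj⟩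
  rw [finrank_tangentSpace]
  change _ = Module.finrank ℝ (EuclideanSpace ℝ (Fin (k + 1)) × ℝ × (Fin (k + 1) → ℝ))
  simp
  ring

end Hyper

/-! ### ### The normal g(ℓ - u) and its shape operator -/

section NormalField

variable {k : ℕ} {G : Type*} {g : G → Matrix (Fin (k + 3)) (Fin (k + 3)) ℂ}

/-- The unit vector normal to the horospheres. -/
def horoNormal (g : G → Matrix (Fin (k + 3)) (Fin (k + 3)) ℂ) (q : G × ℝ × ℝ × Sph k) :
    EuclideanSpace ℂ (Fin (k + 2)) :=
  dhopf (PsiTilde g (1, q)) ((g q.1).mulVec (nullVec k) - PsiTilde g (1, q))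

lemma hform_nullVec_horoPoint (h : ℝ) (y : Fin (k + 1) → ℝ) :
    hform (nullVec k) (horoPoint h y) = -1 := by
  rw [← hform_conj, hform_horoPoint_nullVec]
  simp

lemma hform_lift_horoNormal_self (hgU : ∀ x, g x ∈ U1 (k + 2)) (q : G × ℝ × ℝ × Sph k) :
    hform ((g q.1).mulVec (nullVec k) - PsiTilde g (1, q)) (PsiTilde g (1, q)) = 0 := by
  rw [hform_sub_left, (PsiTilde_mem hgU q : hform _ _ = -1), PsiTilde_one,
    hform_mulVec (hgU _), hform_nullVec_horoPoint, sub_self]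

lemma hform_lift_horoNormal (hgU : ∀ x, g x ∈ U1 (k + 2)) (q : G × ℝ × ℝ × Sph k) :
    hform ((g q.1).mulVec (nullVec k) - PsiTilde g (1, q))
      ((g q.1).mulVec (nullVec k) - PsiTilde g (1, q)) = 1 := by
  rw [hform_sub_right, hform_lift_horoNormal_self hgU, hform_sub_left, hform_mulVec (hgU _),
    PsiTilde_one, hform_mulVec (hgU _), hform_nullVec_self, hform_horoPoint_nullVec]
  norm_num

variable [TopologicalSpace G] [ChartedSpace (EuclideanSpace ℝ (Fin (k + 1))) G]

lemma contMDiffOn_horoNormal (hgU : ∀ x, g x ∈ U1 (k + 2))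
    (hg : ContMDiff (𝓡 (k + 1)) 𝓘(ℝ, Fin (k + 3) → Fin (k + 3) → ℂ) ∞ (entries g))
    (hPsiTilde : IsImmersionOn ((𝓡 1).prod (modelM k)) (PsiTilde g) (univ ×ˢ domM k G)) :
    ContMDiffOn (modelM k) 𝓘(ℝ, EuclideanSpace ℂ (Fin (k + 2))) ∞ (horoNormal g) (domM k G) := by
  have hw : ContMDiffOn (modelM k) 𝓘(ℝ, Fin (k + 3) → ℂ) ∞
      (fun q : G × ℝ × ℝ × Sph k => PsiTilde g (1, q)) (domM k G) :=
    hPsiTilde.1.comp (contMDiff_const.prodMk contMDiff_id).contMDiffOn fun q hq => ⟨mem_univ _, hq⟩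
  have hl : ContMDiff (modelM k) 𝓘(ℝ, Fin (k + 3) → ℂ) ∞
      (fun q : G × ℝ × ℝ × Sph k => (g q.1).mulVec (nullVec k)) :=
    contMDiff_mulVec (hg.comp contMDiff_fst) _
  intro q hq
  have hF : ContDiffAt ℝ ∞ (fun p : (Fin (k + 3) → ℂ) × (Fin (k + 3) → ℂ) => dhopf p.1 p.2)
      (PsiTilde g (1, q), (g q.1).mulVec (nullVec k) - PsiTilde g (1, q)) := by
    have h0 := (normSq_of_mem (PsiTilde_mem hgU q)).1
    refine (PiLp.continuousLinearEquiv 2 ℝ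
      (fun _ : Fin (k + 2) => ℂ)).symm.contDiff.contDiffAt.comp _ (contDiffAt_pi.2 fun i => ?_)
    simp only [div_eq_mul_inv]
    have hinv : ContDiffAt ℝ ∞ (fun p : (Fin (k + 3) → ℂ) × (Fin (k + 3) → ℂ) => (p.1 0)⁻¹)
        (PsiTilde g (1, q), (g q.1).mulVec (nullVec k) - PsiTilde g (1, q)) :=
      ContDiffAt.inv (by fun_prop) h0
    fun_prop
  exact ContDiffAt.comp_contMDiffWithinAt (f := fun q : G × ℝ × ℝ × Sph k =>
    (PsiTilde g (1, q), (g q.1).mulVec (nullVec k) - PsiTilde g (1, q))) hF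
    ((hw q hq).prodMk_space ((hl.contMDiffOn q hq).sub (hw q hq)))

/-- If `Ω` is a CKO-form, then `horoNormal` is a unit normal field. -/
lemma isUnitNormalOn_horoNormal (hgU : ∀ x, g x ∈ U1 (k + 2))
    (hg : ContMDiff (𝓡 (k + 1)) 𝓘(ℝ, Fin (k + 3) → Fin (k + 3) → ℂ) ∞ (entries g))
    (hPsiTilde : IsImmersionOn ((𝓡 1).prod (modelM k)) (PsiTilde g) (univ ×ˢ domM k G))
    (hPsi : IsImmersionOn (modelM k) (PsiG g) (domM k G))
    (hort : ∀ x (Y : TangentSpace (𝓡 (k + 1)) x) (h : ℝ) (y : Fin (k + 1) → ℝ),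
      (hform (horoPoint h y) ((maurerCartan g x Y).mulVec (nullVec k))).re = 0) :
    IsUnitNormalOn (modelM k) (PsiG g) (horoNormal g) (domM k G) := by
  refine ⟨contMDiffOn_horoNormal hgU hg hPsiTilde, fun q hq => ⟨?_, fun v => ?_⟩⟩
  · rw [horoNormal, PsiG, metric_dhopf (PsiTilde_mem hgU q) _ (hform_lift_horoNormal_self hgU q),
      hform_lift_horoNormal hgU, Complex.one_re]
  · rw [differential_PsiG hgU hg hPsi hq, horoNormal, PsiG,
      metric_dhopf (PsiTilde_mem hgU q) _ (hform_lift_horoNormal_self hgU q), PsiTilde_one,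
      ← Matrix.mulVec_sub, hform_mulVec (hgU _)]
    have h1 := congrArg Complex.re (maurerCartan_skew hgU hg q.1 (coordDeriv q v).1
      (horoPoint q.2.1 (radial q)) (nullVec k))
    rw [Complex.add_re, hort, add_zero, Complex.zero_re] at h1
    rw [hform_sub_right, hform_add_left, hform_add_left, hform_horoTangent_nullVec,
      hform_horoTangent_horoPoint]
    simp [h1, maurerCartan_re_self hgU hg]

/-- The lift gℓ - w of the normal has derivative gΩℓ - w'; the last term is the vertical correction
of `covDeriv_eq`. -/
lemma covDeriv_horoNormal (hgU : ∀ x, g x ∈ U1 (k + 2))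
    (hg : ContMDiff (𝓡 (k + 1)) 𝓘(ℝ, Fin (k + 3) → Fin (k + 3) → ℂ) ∞ (entries g))
    (hPsiTilde : IsImmersionOn ((𝓡 1).prod (modelM k)) (PsiTilde g) (univ ×ˢ domM k G))
    (hPsi : IsImmersionOn (modelM k) (PsiG g) (domM k G)) {q : G × ℝ × ℝ × Sph k}
    (hq : q ∈ domM k G) (v : TangentSpace (modelM k) q) {w' : Fin (k + 3) → ℂ}
    (hw' : w' = (g q.1).mulVec ((maurerCartan g q.1 (coordDeriv q v).1).mulVec
        (horoPoint q.2.1 (radial q)) +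
        horoTangent (radial q) (coordDeriv q v).2.1 (coordDeriv q v).2.2)) :
    covDeriv (modelM k) (PsiG g) (horoNormal g) q v = dhopf (PsiTilde g (1, q))
      ((g q.1).mulVec ((maurerCartan g q.1 (coordDeriv q v).1).mulVec (nullVec k)) - w' +
        hform w' (PsiTilde g (1, q)) • ((g q.1).mulVec (nullVec k) - PsiTilde g (1, q))) := by
  have hw := hasDerivAt_PsiTilde hgU hg q v
  rw [← hw'] at hw
  have h := covDeriv_eq (modelM k) (mdifferentiableAt_PsiG hPsi hq)
    (((contMDiffOn_horoNormal hgU hg hPsiTilde).contMDiffAt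
      ((isOpen_domM k G).mem_nhds hq)).mdifferentiableAt (by simp)) hw
    ((hasDerivAt_mulVec_fst hgU hg q v (nullVec k)).sub hw) (PsiTilde_mem hgU _)
    (hform_lift_horoNormal_self hgU _) (fun t => rfl) (Filter.Eventually.of_forall fun t => rfl)
  simpa only [Pi.sub_apply, chartCurve_zero] using h

theorem isHopf_of_orthogonal (hgU : ∀ x, g x ∈ U1 (k + 2))
    (hg : ContMDiff (𝓡 (k + 1)) 𝓘(ℝ, Fin (k + 3) → Fin (k + 3) → ℂ) ∞ (entries g))
    (hPsiTilde : IsImmersionOn ((𝓡 1).prod (modelM k)) (PsiTilde g) (univ ×ˢ domM k G))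
    (hPsi : IsImmersionOn (modelM k) (PsiG g) (domM k G))
    (hort : ∀ x (Y : TangentSpace (𝓡 (k + 1)) x) (h : ℝ) (y : Fin (k + 1) → ℝ),
      (hform (horoPoint h y) ((maurerCartan g x Y).mulVec (nullVec k))).re = 0) :
    IsHopfWithEigenspace (n := k + 2) (modelM k) (PsiG g) (domM k G) 2 1 (k + 1) := by
  have hun := isUnitNormalOn_horoNormal hgU hg hPsiTilde hPsi hort
  refine ⟨?_, fun q _ => hopf_mem_ball (PsiTilde_mem hgU q), hPsi, horoNormal g, hun,
    fun q hq => ?_⟩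
  · simp
    ring
  have hinj := hPsi.2 q hq
  have hcov := covDeriv_horoNormal hgU hg hPsiTilde hPsi hq
  -- ∇N is tangent: Re((w', N)) = 0 since N is normal, ((w', w)) is imaginary while N has length 1,
  -- and gΩℓ is orthogonal to g(ℓ - u) by `hort` and skewness.
  have hlift : ∃ A : Module.End ℝ (TangentSpace (modelM k) q),
      ∀ v, differential (modelM k) (PsiG g) q (A v) =
        (-covDerivLinear (modelM k) (PsiG g) (horoNormal g) q) v := by
    refine LinearMap.exists_lift_of_finrank (φ := metricLeft (PsiG g q) (horoNormal g q))
      hinj ?_ (hun.2 q hq).2 ?_ ?_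
    · intro h
      have h1 : metric (PsiG g q) (horoNormal g q) (horoNormal g q) = 0 :=
        LinearMap.congr_fun h (horoNormal g q)
      rw [(hun.2 q hq).1] at h1
      exact one_ne_zero h1
    · intro v
      rw [LinearMap.neg_apply, map_neg, neg_eq_zero]
      change metric (PsiG g q) (covDeriv (modelM k) (PsiG g) (horoNormal g) q v) (horoNormal g q) = 0
      have h0 := (hun.2 q hq).2 v
      rw [differential_PsiG hgU hg hPsi hq] at h0
      rw [hcov v rfl]
      generalize hwd : (g q.1).mulVec ((maurerCartan g q.1 (coordDeriv q v).1).mulVec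
          (horoPoint q.2.1 (radial q)) +
          horoTangent (radial q) (coordDeriv q v).2.1 (coordDeriv q v).2.2) = w' at h0 ⊢
      rw [horoNormal, PsiG, metric_dhopf (PsiTilde_mem hgU q) _ (hform_lift_horoNormal_self hgU q)]
        at h0 ⊢
      have h1 : (hform w' (PsiTilde g (1, q))).re = 0 := by
        rw [← hwd, PsiTilde_one, hform_mulVec (hgU _), hform_add_left, Complex.add_re,
          maurerCartan_re_self hgU hg, hform_horoTangent_horoPoint]
        simp
      have h2 : (hform ((g q.1).mulVec ((maurerCartan g q.1 (coordDeriv q v).1).mulVec (nullVec k)))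
          ((g q.1).mulVec (nullVec k) - PsiTilde g (1, q))).re = 0 := by
        rw [PsiTilde_one, ← Matrix.mulVec_sub, hform_mulVec (hgU _), hform_sub_right, Complex.sub_re,
          maurerCartan_re_self hgU hg, hform_re_comm, hort, sub_zero]
      rw [hform_add_left, hform_sub_left, hform_smul_left, hform_lift_horoNormal hgU, mul_one,
        Complex.add_re, Complex.sub_re, h0, h1, h2]
      simp
    · rw [finrank_tangentSpace]
      rw [← Module.finrank_mul_finrank ℝ ℂ (EuclideanSpace ℂ (Fin (k + 2)))]
      simp [Complex.finrank_real_complex]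
      ring
  obtain ⟨A, hA⟩ := hlift
  have hA' : ∀ v, covDeriv (modelM k) (PsiG g) (horoNormal g) q v =
      -differential (modelM k) (PsiG g) q (A v) := by
    intro v
    rw [hA, LinearMap.neg_apply, neg_neg]
    rfl
  let e := LinearEquiv.ofBijective (coordDeriv q) (bijective_coordDeriv hgU hg hPsi hq)
  have he : ∀ c, coordDeriv q (e.symm c) = c := e.apply_symm_apply
  -- The structure vector is ∂/∂h: T(1,0) = -iℓ, and dπ(gℓ) = N because dπ(gu) = 0.
  refine ⟨A, hA', ⟨e.symm (0, 1, 0), ?_, hinj ?_⟩, ?_⟩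
  · rw [IsStructureVectorAt, differential_PsiG hgU hg hPsi hq, he]
    simp only [map_zero, Matrix.zero_mulVec, zero_add, horoTangent_one_zero]
    rw [horoNormal, dhopf_sub, dhopf_self (PsiTilde_mem hgU q), sub_zero, Matrix.mulVec_neg,
      Matrix.mulVec_smul, dhopf_neg, dhopf_smul]
  -- Here -w' = igℓ projects to iN and ((w', w)) = i contributes a second iN.
  · rw [map_smul, ← neg_inj, ← hA', hcov _ rfl, differential_PsiG hgU hg hPsi hq, he]
    simp only [map_zero, Matrix.zero_mulVec, zero_add]
    rw [PsiTilde_one, hform_mulVec (hgU _), hform_horoTangent_horoPoint, ← PsiTilde_one,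
      horoTangent_one_zero, dhopf_add, dhopf_smul, dhopf_sub, dhopf_sub,
      dhopf_self (PsiTilde_mem hgU q), Matrix.mulVec_neg, Matrix.mulVec_smul, dhopf_neg,
      dhopf_smul, Matrix.mulVec_zero, dhopf_zero, ← Complex.coe_smul]
    push_cast
    module
  -- Directions (0,0,c) have ((w', w)) = 0 and no Ω term, so ∇N = -dΨ. They form a space of
  -- dimension k + 1 = n - 1.
  · let j : (Fin (k + 1) → ℝ) →ₗ[ℝ] TangentSpace (modelM k) q :=
      e.symm.toLinearMap ∘ₗ LinearMap.inr ℝ _ _ ∘ₗ LinearMap.inr ℝ _ _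
    have hj : Function.Injective j :=
      e.symm.injective.comp (LinearMap.inr_injective.comp LinearMap.inr_injective)
    have : FiniteDimensional ℝ (TangentSpace (modelM k) q) := inferInstanceAs
      (FiniteDimensional ℝ (EuclideanSpace ℝ (Fin (k + 1)) × ℝ × ℝ × EuclideanSpace ℝ (Fin k)))
    have hle : LinearMap.range j ≤ Module.End.eigenspace A 1 := by
      rintro _ ⟨c, rfl⟩
      rw [Module.End.mem_eigenspace_iff, one_smul]
      refine hinj ?_
      have hjc : coordDeriv q (j c) = (0, 0, c) := he _
      rw [← neg_inj, ← hA', hcov _ rfl, differential_PsiG hgU hg hPsi hq, hjc]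
      simp only [map_zero, Matrix.zero_mulVec, zero_add]
      rw [PsiTilde_one, hform_mulVec (hgU _), hform_horoTangent_horoPoint]
      simp [dhopf_neg]
    have h1 := Submodule.finrank_mono hle
    rwa [LinearMap.finrank_range_of_inj hj, Module.finrank_fin_fun] at h1

end NormalField

/-! ### ### The Hopf equation determines the normal -/

/-- Existence suffices: in `horLift_normal_eq` the derivative V' is eliminated between two
equations. -/
lemma exists_hasDerivAt_horLift {n : ℕ} {w : ℝ → Fin (n + 1) → ℂ} {w' : Fin (n + 1) → ℂ}
    {X : ℝ → EuclideanSpace ℂ (Fin n)} {X' : EuclideanSpace ℂ (Fin n)} {t : ℝ}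
    (hw : HasDerivAt w w' t) (hX : HasDerivAt X X' t) :
    ∃ V' : Fin (n + 1) → ℂ, HasDerivAt (fun s => horLift (w s) (X s)) V' t := by
  have hXk : ∀ k, HasDerivAt (fun s => X s k) (X' k) t := fun k =>
    hasDerivAt_pi.1 ((PiLp.continuousLinearEquiv 2 ℝ
      (fun _ : Fin n => ℂ)).hasFDerivAt.comp_hasDerivAt t hX) k
  have ha : HasDerivAt (fun s => (Fin.cons 0 (fun k => w s 0 * X s k) : Fin (n + 1) → ℂ))
      (Fin.cons 0 fun k => w' 0 * X t k + w t 0 * X' k) t := by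
    refine hasDerivAt_pi.2 fun i => Fin.cases ?_ (fun k => ?_) i
    · simpa using hasDerivAt_const t (0 : ℂ)
    · exact (hasDerivAt_pi.1 hw 0).mul (hXk k)
  exact ⟨_, ha.add ((ha.hform hw).smul hw)⟩

section Equivalence

variable {k : ℕ}

variable {G : Type*} [TopologicalSpace G] [ChartedSpace (EuclideanSpace ℝ (Fin (k + 1))) G]
  {g : G → Matrix (Fin (k + 3)) (Fin (k + 3)) ℂ}

/-- The horizontal lift of a unit normal is orthogonal to the image of the differential. -/
lemma re_hform_horLift_normal (hgU : ∀ x, g x ∈ U1 (k + 2))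
    (hg : ContMDiff (𝓡 (k + 1)) 𝓘(ℝ, Fin (k + 3) → Fin (k + 3) → ℂ) ∞ (entries g))
    (hPsi : IsImmersionOn (modelM k) (PsiG g) (domM k G))
    {N : G × ℝ × ℝ × Sph k → EuclideanSpace ℂ (Fin (k + 2))}
    (hN : IsUnitNormalOn (modelM k) (PsiG g) N (domM k G)) {q : G × ℝ × ℝ × Sph k}
    (hq : q ∈ domM k G) (Y : TangentSpace (𝓡 (k + 1)) q.1) (s : ℝ) (c : Fin (k + 1) → ℝ) :
    (hform ((g q.1).mulVec ((maurerCartan g q.1 Y).mulVec (horoPoint q.2.1 (radial q)) +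
      horoTangent (radial q) s c)) (horLift (PsiTilde g (1, q)) (N q))).re = 0 := by
  obtain ⟨v, hv⟩ := (bijective_coordDeriv hgU hg hPsi hq).2 (Y, s, c)
  have h := (hN.2 q hq).2 v
  have hw := PsiTilde_mem hgU q
  rw [differential_PsiG hgU hg hPsi hq, hv, ← dhopf_horLift hw (N q), PsiG,
    metric_dhopf hw _ (hform_horLift_self hw _)] at h
  exact h

/-- If `A ξ = 2 ξ`, then the unit normal is `horoNormal`. -/
lemma horLift_normal_eq (hgU : ∀ x, g x ∈ U1 (k + 2))
    (hg : ContMDiff (𝓡 (k + 1)) 𝓘(ℝ, Fin (k + 3) → Fin (k + 3) → ℂ) ∞ (entries g))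
    (hPsi : IsImmersionOn (modelM k) (PsiG g) (domM k G))
    {N : G × ℝ × ℝ × Sph k → EuclideanSpace ℂ (Fin (k + 2))}
    (hN : IsUnitNormalOn (modelM k) (PsiG g) N (domM k G)) {q : G × ℝ × ℝ × Sph k}
    (hq : q ∈ domM k G) {A : Module.End ℝ (TangentSpace (modelM k) q)}
    (hA : IsShapeOperatorAt (modelM k) (PsiG g) N q A) {ξ : TangentSpace (modelM k) q}
    (hξ : IsStructureVectorAt (modelM k) (PsiG g) N q ξ) (hAξ : A ξ = (2 : ℝ) • ξ) :
    horLift (PsiTilde g (1, q)) (N q) =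
      (g q.1).mulVec (nullVec k - horoPoint q.2.1 (radial q)) := by
  have hort := fun {q : G × ℝ × ℝ × Sph k} (hq : q ∈ domM k G) =>
    re_hform_horLift_normal hgU hg hPsi hN hq
  have hw := PsiTilde_mem hgU q
  set y := radial q with hy
  set u := horoPoint q.2.1 y with hu
  have hwu : PsiTilde g (1, q) = (g q.1).mulVec u := PsiTilde_one g q
  set ν := horLift (PsiTilde g (1, q)) (N q) with hν
  have hνw : hform ν (PsiTilde g (1, q)) = 0 := hform_horLift_self hw _
  obtain ⟨ν₀, hν₀⟩ : ∃ ν₀, (g q.1).mulVec ν₀ = ν :=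
    ⟨(g q.1)⁻¹.mulVec ν, by rw [Matrix.mulVec_mulVec, mul_inv_of_mem_U1 (hgU _), Matrix.one_mulVec]⟩
  obtain ⟨a, b, hab⟩ := exists_eq_of_orthogonal_horoTangent q.2.1 y ν₀
    (by rw [← hform_mulVec (hgU q.1), hν₀, ← hu, ← hwu, hνw]) (fun s c => by
      have h := hort hq 0 s c
      rw [map_zero, Matrix.zero_mulVec, zero_add, ← hν, ← hν₀, hform_mulVec (hgU _)] at h
      rw [hform_re_comm]
      exact h)
  rw [← hu] at hab
  have hηu : hform (nullVec k - u) u = 0 := by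
    rw [hform_sub_left, hform_nullVec_horoPoint, hform_horoPoint_self, sub_self]
  have hηη : hform (nullVec k - u) (nullVec k - u) = 1 := by
    rw [hform_sub_right, hηu, hform_sub_left, hform_nullVec_self, hform_horoPoint_nullVec]
    norm_num
  have hTη : ∀ s c, hform (horoTangent y s c) (nullVec k - u) = -(Complex.I * s) := by
    intro s c
    rw [hform_sub_right, hform_horoTangent_nullVec, hform_horoTangent_horoPoint, zero_sub]
  have hηT : ∀ s c, hform (nullVec k - u) (horoTangent y s c) = Complex.I * s := by
    intro s c
    rw [← hform_conj, hTη]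
    simp
  have hνη : hform ν₀ (nullVec k - u) = a := by
    rw [hab, hform_add_left, hform_smul_left, hform_smul_left, hηη, hTη]
    simp
  have hνT : ∀ s c, hform ν₀ (horoTangent y s c) =
      Complex.I * (a * s + (b ⬝ᵥ c : ℝ)) := by
    intro s c
    rw [hab, hform_add_left, hform_smul_left, hform_smul_left, hηT, hform_horoTangent]
    ring
  have hnorm : a ^ 2 + b ⬝ᵥ b = 1 := by
    have h := (hN.2 q hq).1
    rw [← dhopf_horLift hw (N q), PsiG, metric_dhopf hw _ (hform_horLift_self hw _), ← hν, ← hν₀,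
      hform_mulVec (hgU _)] at h
    have h2 : hform ν₀ ν₀ = ((a ^ 2 + b ⬝ᵥ b : ℝ) : ℂ) := by
      conv_lhs => arg 2; rw [hab]
      rw [hform_add_right, hform_smul_right, hform_smul_right, hνη, hνT, Complex.conj_ofReal,
        Complex.conj_I]
      push_cast
      linear_combination -((b ⬝ᵥ b : ℝ) : ℂ) * Complex.I_sq
    rwa [h2, Complex.ofReal_re] at h
  -- -iν and gT(a,b) differ by the vertical vector iaw, so ξ = -JN has coordinates (0, a, b).
  have hξc : coordDeriv q ξ = (0, a, b) := by
    obtain ⟨v, hv⟩ := (bijective_coordDeriv hgU hg hPsi hq).2 (0, a, b)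
    rw [← hv]
    congr 1
    refine hPsi.2 q hq ?_
    rw [hξ, differential_PsiG hgU hg hPsi hq, hv]
    simp only [map_zero, Matrix.zero_mulVec, zero_add]
    have h1 : (g q.1).mulVec (horoTangent y a b) =
        -(Complex.I • ν) - (Complex.I * a) • PsiTilde g (1, q) := by
      rw [hwu, ← hν₀, hab, horoTangent_smul_add, ← Matrix.mulVec_smul, ← Matrix.mulVec_smul,
        ← Matrix.mulVec_neg, ← Matrix.mulVec_sub]
      congr 1
      simp only [smul_add, smul_smul, Complex.I_mul_I]
      module
    rw [h1, dhopf_sub, dhopf_smul, dhopf_self hw, smul_zero, sub_zero, dhopf_neg, dhopf_smul,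
      dhopf_horLift hw]
  have hW := hasDerivAt_PsiTilde hgU hg q ξ
  have hL := hasDerivAt_mulVec_fst hgU hg q ξ (nullVec k)
  simp only [hξc, map_zero, Matrix.zero_mulVec, zero_add, Matrix.mulVec_zero] at hW hL
  have hNq : MDifferentiableAt (modelM k) 𝓘(ℝ, EuclideanSpace ℂ (Fin (k + 2))) N q :=
    (hN.1.contMDiffAt ((isOpen_domM k G).mem_nhds hq)).mdifferentiableAt (by simp)
  obtain ⟨V', hV⟩ := exists_hasDerivAt_horLift hW (hasDerivAt_comp_chartCurve (modelM k) hNq ξ)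
  have hcov := covDeriv_eq (modelM k) (mdifferentiableAt_PsiG hPsi hq) hNq hW hV (PsiTilde_mem hgU _)
    (hform_horLift_self (PsiTilde_mem hgU _) _) (fun t => rfl)
    (Filter.Eventually.of_forall fun t => (dhopf_horLift (PsiTilde_mem hgU _) _).symm)
  rw [hA, hAξ, map_smul, hξ, chartCurve_zero, ← hν] at hcov
  have hηw : hform ((g q.1).mulVec (nullVec k - u)) (PsiTilde g (1, q)) = 0 := by
    rw [hwu, hform_mulVec (hgU _), hηu]
  -- First equation for V': ∇_ξN = 2iN paired with the horizontal vector -ig(ℓ - u).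
  have h1 : (hform ((2 * Complex.I) • ν) (-(Complex.I • (g q.1).mulVec (nullVec k - u)))).re =
      (hform (V' + hform ((g q.1).mulVec (horoTangent y a b)) (PsiTilde g (1, q)) • ν)
        (-(Complex.I • (g q.1).mulVec (nullVec k - u)))).re := by
    have hz : hform (-(Complex.I • (g q.1).mulVec (nullVec k - u))) (PsiTilde g (1, q)) = 0 := by
      rw [hform_neg_left, hform_smul_left, hηw, mul_zero, neg_zero]
    rw [← metric_dhopf hw _ hz, ← metric_dhopf hw _ hz, ← hcov, dhopf_smul, dhopf_horLift hw,
      ← Complex.coe_smul]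
    congr 1
    push_cast
    module
  -- Second equation for V': -igℓ = gT(1,0) stays orthogonal to the normal lift along the curve, and
  -- so does -ig(ℓ - u), as the lift is horizontal. This orthogonality relation is differentiated.
  have h2 := (hV.hform ((hL.fun_sub hW).fun_const_smul (-Complex.I))).re
  have h3 : (fun t => (hform (horLift (PsiTilde g (1, chartCurve (modelM k) q ξ t))
      (N (chartCurve (modelM k) q ξ t))) ((-Complex.I) •
        ((g (chartCurve (modelM k) q ξ t).1).mulVec (nullVec k) -
          PsiTilde g (1, chartCurve (modelM k) q ξ t)))).re) =ᶠ[nhds 0] fun _ => 0 := by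
    have hev : ∀ᶠ t in nhds (0 : ℝ), chartCurve (modelM k) q ξ t ∈ domM k G := by
      refine (continuousAt_chartCurve (modelM k) q ξ).eventually_mem ?_
      rw [chartCurve_zero]
      exact (isOpen_domM k G).mem_nhds hq
    filter_upwards [hev] with t ht
    have h := hort ht 0 1 0
    rw [map_zero, Matrix.zero_mulVec, zero_add, horoTangent_one_zero, hform_re_comm,
      ← neg_smul, Matrix.mulVec_smul] at h
    rw [smul_sub, hform_sub_right, Complex.sub_re, h, hform_smul_right,
      hform_horLift_self (PsiTilde_mem hgU _), mul_zero, Complex.zero_re, sub_zero]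
  have h4 := h2.unique ((hasDerivAt_const (0 : ℝ) (0 : ℝ)).congr_of_eventuallyEq h3)
  rw [chartCurve_zero, ← hν] at h4
  have e1 : (g q.1).mulVec (nullVec k) - PsiTilde g (1, q) = (g q.1).mulVec (nullVec k - u) := by
    rw [hwu, Matrix.mulVec_sub]
  have e2 : hform ν ((g q.1).mulVec (nullVec k - u)) = a := by
    rw [← hν₀, hform_mulVec (hgU _), hνη]
  have e3 : hform ((g q.1).mulVec (horoTangent y a b)) (PsiTilde g (1, q)) = Complex.I * a := by
    rw [hwu, hform_mulVec (hgU _), hform_horoTangent_horoPoint]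
  have e4 : hform ν ((g q.1).mulVec (horoTangent y a b)) = Complex.I := by
    rw [← hν₀, hform_mulVec (hgU _), hνT]
    have : ((a ^ 2 + b ⬝ᵥ b : ℝ) : ℂ) = 1 := by rw [hnorm]; simp
    push_cast at this
    linear_combination Complex.I * this
  rw [e1, ← hy, zero_sub, smul_neg, neg_smul, neg_smul, neg_neg, hform_neg_right, hform_smul_right,
    hform_smul_right, e4] at h4
  rw [e3, hform_add_left, hform_neg_right, hform_neg_right, hform_neg_right, hform_smul_left,
    hform_smul_left, hform_smul_right, hform_smul_right, e2] at h1
  simp at h1 h4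
  -- `h4` gives Re((V', -ig(ℓ - u))) = -1, and `h1` becomes -2a = -1 - a², that is, (a - 1)² = 0.
  have ha : a = 1 := by nlinarith
  have hb : b = 0 := by
    rw [ha] at hnorm
    exact dotProduct_self_eq_zero.1 (by linarith)
  rw [← hν₀, hab, ha, hb, horoTangent_zero_zero]
  simp

/-- With the normal lift known to be g(ℓ - u), its orthogonality to gΩu reads Re((Ωu, ℓ)) = 0,
because Re((Ωu, u)) = 0; skewness moves Ω to ℓ. -/
theorem orthogonal_of_isHopf (hgU : ∀ x, g x ∈ U1 (k + 2))
    (hg : ContMDiff (𝓡 (k + 1)) 𝓘(ℝ, Fin (k + 3) → Fin (k + 3) → ℂ) ∞ (entries g))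
    {d : ℕ} (h : IsHopfWithEigenspace (n := k + 2) (modelM k) (PsiG g) (domM k G) 2 1 d)
    {q : G × ℝ × ℝ × Sph k} (hq : q ∈ domM k G) (Y : TangentSpace (𝓡 (k + 1)) q.1) :
    (hform (horoPoint q.2.1 (radial q)) ((maurerCartan g q.1 Y).mulVec (nullVec k))).re = 0 := by
  obtain ⟨-, -, hPsi, N, hN, hS⟩ := h
  obtain ⟨A, hA, ⟨ξ, hξ, hAξ⟩, -⟩ := hS q hq
  have h1 := re_hform_horLift_normal hgU hg hPsi hN hq Y 0 0
  rw [horLift_normal_eq hgU hg hPsi hN hq hA hξ hAξ, hform_mulVec (hgU _), horoTangent_zero_zero,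
    add_zero, hform_sub_right, Complex.sub_re, maurerCartan_re_self hgU hg, sub_zero] at h1
  have h2 := congrArg Complex.re (maurerCartan_skew hgU hg q.1 Y
    (horoPoint q.2.1 (radial q)) (nullVec k))
  rw [Complex.add_re, h1, zero_add] at h2
  exact h2

end Equivalence

end CHn

end

/-! ### ### The equivalence -/

theorem mainTheorem2 (k : ℕ) {G : Type*} [TopologicalSpace G]
    [ChartedSpace (EuclideanSpace ℝ (Fin (k + 1))) G] [IsManifold (𝓡 (k + 1)) ∞ G]
    (g : G → Matrix (Fin (k + 3)) (Fin (k + 3)) ℂ)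
    (hgU : ∀ x, g x ∈ CHn.U1 (k + 2))
    (hg : CHn.IsImmersionOn (𝓡 (k + 1)) (CHn.entries g) Set.univ)
    (hPsiTilde : CHn.IsImmersionOn ((𝓡 1).prod (CHn.modelM k)) (CHn.PsiTilde g)
      (Set.univ ×ˢ CHn.domM k G))
    (hPsi : CHn.IsImmersionOn (CHn.modelM k) (CHn.PsiG g) (CHn.domM k G)) :
    CHn.IsCKO (CHn.maurerCartan g) ↔
      CHn.IsHopfWithEigenspace (n := k + 2) (CHn.modelM k) (CHn.PsiG g) (CHn.domM k G) 2 1 (k + 1)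
    := by
  have hgs := contMDiffOn_univ.1 hg.1
  constructor
  · rintro ⟨α₀, α₁, ξ, y₀, y₁, w₁, w₂, -, hΩ, -⟩
    refine CHn.isHopf_of_orthogonal hgU hgs hPsiTilde hPsi fun x Y h y => ?_
    rw [hΩ]
    exact CHn.re_hform_horoPoint_ckoMatrix _ _ _ _ _ _ _ _ _
  · intro hH
    refine CHn.isCKO_of_orthogonal hgU hgs fun x Y h l j hl => ?_
    -- The points p = e_j suffice for `eq_ckoMatrix`. For k = 0 the only one is p = 1, the point of
    -- S⁰ that is kept in `domM`.
    let p : CHn.Sph k := ⟨EuclideanSpace.single j 1, by simp⟩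
    have hq : (x, h, l, p) ∈ CHn.domM k G := by
      change if k = 0 then p.1 0 = 1 else 0 < l
      split_ifs with hk
      · subst hk
        simp [p, Fin.fin_one_eq_zero j]
      · exact hl
    have hr : CHn.radial (x, h, l, p) = Pi.single j l := by
      funext i
      by_cases hi : i = j <;> simp [CHn.radial, p, hi]
    have h1 := CHn.orthogonal_of_isHopf hgU hgs hH hq Y
    rwa [hr] at h1
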